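/- Setup. Let $N$ and $k_1,\dots,k_N$ be given, $k=\sum_i k_i$, $m=k+N$. On a probability space let $x_t=(x_{1,t}',\dots,x_{N,t}')'\in\mathbb R^{k}$, with $x_{i,t}\in\mathbb R^{k_i}$, and $u_t\in\mathbb R^N$, $t\in\mathbb Z$, be random vectors with $\mathbb E[x_t]=\mu_x$ and $\mathbb E[u_t]=0$, and let $$y_{i,t}=\alpha_i+x_{i,t}'\beta_i+u_{i,t},\qquad i=1,\dots,N .$$ Put $\bar z_t=((x_t-\mu_x)',u_t')'\in\mathbb R^m$. Let $\mathscr H_t$ be the closed linear span in $L^2$ of all components of $\bar z_s$, $s\le t$; let $\mathscr P_{t-1}$ be the $L^2$-orthogonal projection onto $\mathscr H_{t-1}$ and $\mathscr P^{(p)}_{t-1}$ the one onto the span of the components of $\bar z_{t-1},\dots,\bar z_{t-p}$, both applied component by component. Let $\varepsilon_t=(\varepsilon_{x,t}',\varepsilon_{u,t}')'=\bar z_t-\mathscr P_{t-1}[\bar z_t]$. Assumption 1. The process $\{\bar z_t\}$ is covariance-stationary with finite second moments and purely nondeterministic ($\bigcap_t\mathscr H_t=\{0\}$), and for the fixed $p_0\ge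 1$ one has $\mathscr P_{t-1}[\bar z_t]=\mathscr P^{(p_0)}_{t-1}[\bar z_t]$ for all $t$. The innovations $\{\varepsilon_t\}$ are strongly mixing and for some $\delta>0$ their mixing coefficients $$\alpha_\varepsilon(\ell)=\sup_t\ \sup\{|\mathbb P(A\cap B)-\mathbb P(A)\mathbb P(B)|: A\in\sigma(\varepsilon_s,s\le t-\ell),\ B\in\sigma(\varepsilon_s,s\ge t)\}$$ satisfy $\sum_{\ell\ge1}\alpha_\varepsilon(\ell)^{\delta/(2+\delta)}<\infty$, while $\sup_t\mathbb E\|\varepsilon_t\|^{4+2\delta}<\infty$. The matrix $\Sigma=\mathbb E[\varepsilon_t\varepsilon_t']$ is positive definite. Assumption 2. With $X_t=\mathrm{blkdiag}(x_{1,t},\dots,x_{N,t})\in\mathbb R^{k\times N}$ and $Z_t'=[I_N,X_t']$, the matrix $\mathbb E[Z_tZ_t']$ is positive definite. Lemma. Suppose Assumptions 1 and 2 hold. Then there are unique matrices $\Psi_1,\dots,\Psi_{p_0}\in\mathbb R^{m\times m}$ with $\bar z_t=\sum_{j=1}^{p_0}\Psi_j\bar z_{t-j}+\varepsilon_t$ almost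 surely for all $t$. Write $$\Psi_j=\begin{bmatrix}\Psi_{xx,j}&\Psi_{xu,j}\\ \Psi_{ux,j}&\Psi_{uu,j}\end{bmatrix},\qquad \Sigma=\begin{bmatrix}\Sigma_{xx}&\Sigma_{xu}\\ \Sigma_{ux}&\Sigma_{uu}\end{bmatrix}$$ for their blocks. Assume that one of the following conditions holds: (BD) $\Psi_{xu,j}=0$ and $\Psi_{ux,j}=0$ for all $j$, and $\Sigma_{xu}=0$; (GEXOG) $\Psi_{ux,j}=0$ for all $j$, and $\Sigma_{xu}=0$; (EBD) $\Sigma_{xu}=0$. For each $i$ let $$w_{i,t}=(1,x_{i,t}',y_{t-1}',\dots,y_{t-p_0}',x_{t-1}',\dots,x_{t-p_0}')',\qquad \theta_i=(\gamma_i,\beta_i',\psi_{uu,1,i}',\dots,\psi_{uu,p_0,i}',\lambda_{1,i}',\dots,\lambda_{p_0,i}')',$$ where $\gamma=(I_N-\sum_j\Psi_{uu,j})\alpha-\sum_j\Psi_{ux,j}\mu_x$, where $\psi_{uu,j,i}'$ and $\lambda_{j,i}'$ are the $i$-th rows of $\Psi_{uu,j}$ and of $\Lambda_j=\Psi_{ux,j}-\Psi_{uu,j}B$,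 and $B=\mathrm{blkdiag}(\beta_1',\dots,\beta_N')$. Let $$\widehat\theta_i^{\mathrm D}=\Bigl(\frac1{T-p_0}\sum_{t=p_0+1}^Tw_{i,t}w_{i,t}'\Bigr)^{-1}\Bigl(\frac1{T-p_0}\sum_{t=p_0+1}^Tw_{i,t}y_{i,t}\Bigr)$$ be the equation-by-equation OLS estimator. Then, for each $i=1,\dots,N$, as $T\to\infty$ with $p_0$ fixed, the matrix inverted here is nonsingular with probability tending to one, and $\widehat\theta_i^{\mathrm D}\xrightarrow{p}\theta_i$. -/

import Mathlib

open MeasureTheory Filter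
open scoped NNReal ENNReal Topology

noncomputable section

namespace Durbin

/-! ### Second-order theory of a vector process on `ℤ` -/

section Series

variable {Ω : Type*} [MeasurableSpace Ω] {ι : Type*}

/-- The class in `L²` of a square-integrable random variable (and `0` if it is not one). -/
def toL2 (μ : Measure Ω) (f : Ω → ℝ) : Lp ℝ 2 μ :=
  open Classical in if h : MemLp f 2 μ then h.toLp f else 0

/-- The closed linear span in `L²` of all the components of `Z s`, for the times `s ∈ S`.
(For finite `S` and finitely many components the span is finite dimensional, so it is already
closed.) Finite linear combinations of components are the same as the components of finite
combinations of the vectors `Z s` with matrix coefficients. -/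
def linSpace (μ : Measure Ω) (Z : ℤ → Ω → ι → ℝ) (S : Set ℤ) : Submodule ℝ (Lp ℝ 2 μ) :=
  (Submodule.span ℝ {f | ∃ s ∈ S, ∃ a : ι, f = toL2 μ (fun ω => Z s ω a)}).topologicalClosure

/-- The `L²`-orthogonal projection of the component `a` of `Z t` onto the closed linear span of
the components of `Z s`, `s ∈ S`. -/
def linPred (μ : Measure Ω) (Z : ℤ → Ω → ι → ℝ) (S : Set ℤ) (t : ℤ) (a : ι) : Lp ℝ 2 μ :=
  haveI : CompleteSpace (linSpace μ Z S) :=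
    (Submodule.isClosed_topologicalClosure _).completeSpace_coe
  (linSpace μ Z S).starProjection (toL2 μ (fun ω => Z t ω a))

/-- The one-step-ahead linear innovation of `Z` at time `t`: component by component, `Z t` minus
its projection onto the closed linear span of the whole past `Z (t-1), Z (t-2), …`. -/
def innov (μ : Measure Ω) (Z : ℤ → Ω → ι → ℝ) (t : ℤ) (ω : Ω) (a : ι) : ℝ :=
  (toL2 μ (fun ω => Z t ω a) - linPred μ Z (Set.Iic (t - 1)) t a : Lp ℝ 2 μ) ω

/-- The innovation covariance matrix `E[ε_t ε_t']`. -/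
def innovCov (μ : Measure Ω) (Z : ℤ → Ω → ι → ℝ) (t : ℤ) : Matrix ι ι ℝ :=
  Matrix.of fun a b => ∫ ω, innov μ Z t ω a * innov μ Z t ω b ∂μ

/-- `Z` has finite second moments, a constant mean and autocovariances that depend only on the
lag. -/
structure CovStationary (μ : Measure Ω) (Z : ℤ → Ω → ι → ℝ) : Prop where
  memLp : ∀ t a, MemLp (fun ω => Z t ω a) 2 μ
  mean : ∀ s t a, ∫ ω, Z s ω a ∂μ = ∫ ω, Z t ω a ∂μ
  cov : ∀ s t h a b,
    ProbabilityTheory.covariance (fun ω => Z s ω a) (fun ω => Z (s - h) ω b) μ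
      = ProbabilityTheory.covariance (fun ω => Z t ω a) (fun ω => Z (t - h) ω b) μ

/-- The remote linear past of `Z` is trivial. -/
def PurelyNondeterministic (μ : Measure Ω) (Z : ℤ → Ω → ι → ℝ) : Prop :=
  ⨅ n : ℤ, linSpace μ Z (Set.Iic n) = ⊥

/-- The best linear predictor from the whole past only uses the last `p` vectors. -/
def FinitePredictor (μ : Measure Ω) (Z : ℤ → Ω → ι → ℝ) (p : ℕ) : Prop :=
  ∀ t a, linPred μ Z (Set.Iic (t - 1)) t a = linPred μ Z (Set.Icc (t - p) (t - 1)) t a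

/-- The σ-algebra generated by `V s`, `s ∈ S`. -/
abbrev sigmaOf (V : ℤ → Ω → ι → ℝ) (S : Set ℤ) : MeasurableSpace Ω :=
  ⨆ s ∈ S, MeasurableSpace.comap (V s) inferInstance

/-- The strong mixing coefficient `α(ℓ)`: the supremum over `t`, over `A` in the σ-algebra of
`V s`, `s ≤ t - ℓ`, and over `B` in the σ-algebra of `V s`, `s ≥ t`, of
`|P(A ∩ B) - P(A) P(B)|`. -/
def alphaMix (μ : Measure Ω) (V : ℤ → Ω → ι → ℝ) (l : ℕ) : ℝ :=
  sSup {r | ∃ (t : ℤ) (A B : Set Ω), MeasurableSet[sigmaOf V (Set.Iic (t - l))] A ∧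
    MeasurableSet[sigmaOf V (Set.Ici t)] B ∧ r = |μ.real (A ∩ B) - μ.real A * μ.real B|}

/-- Finite-predictor exactness at lag `p`, together with mixing, moments and nondegeneracy of the
innovations. The moments are bounded uniformly in time. -/
structure Assumption1 [Fintype ι] (μ : Measure Ω) (Z : ℤ → Ω → ι → ℝ) (p : ℕ) : Prop where
  covStationary : CovStationary μ Z
  purelyNondet : PurelyNondeterministic μ Z
  one_le : 1 ≤ p
  finitePredictor : FinitePredictor μ Z p
  mixing : ∃ δ : ℝ, 0 < δ ∧
    Tendsto (fun l : ℕ => alphaMix μ (innov μ Z) l) atTop (𝓝 0) ∧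
    Summable (fun l : ℕ => alphaMix μ (innov μ Z) (l + 1) ^ (δ / (2 + δ))) ∧
    ∃ C : ℝ≥0, ∀ t, ∫⁻ ω, ‖innov μ Z t ω‖ₑ ^ (4 + 2 * δ) ∂μ ≤ C
  posDef : ∀ t, (innovCov μ Z t).PosDef

/-- `Z` satisfies the vector autoregression `Z_t = ∑_{j=1}^p Ψ_j Z_{t-j} + ε_t` driven by its own
innovations (`Ψ j` is the coefficient of lag `j + 1`, for `j = 0, …, p - 1`). -/
def IsVAR [Fintype ι] (μ : Measure Ω) (Z : ℤ → Ω → ι → ℝ) (p : ℕ)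
    (Ψ : Fin p → Matrix ι ι ℝ) : Prop :=
  ∀ t : ℤ, ∀ᵐ ω ∂μ, Z t ω = ∑ j : Fin p, (Ψ j).mulVec (Z (t - (j + 1)) ω) + innov μ Z t ω

end Series

/-! ### The regression system -/

section Model

variable {Ω : Type*} [MeasurableSpace Ω] {N : ℕ} {k : Fin N → ℕ}

/-- Positions in the stacked regressor vector `x_t = (x_{1,t}', …, x_{N,t}')'`. -/
abbrev XIdx (k : Fin N → ℕ) : Type := Σ i : Fin N, Fin (k i)

/-- Positions in `z_t = (x_t', u_t')'`. -/
abbrev ZIdx (k : Fin N → ℕ) : Type := XIdx k ⊕ Fin N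

/-- The centred joint process `(x_t - μ_x, u_t)`. -/
def zbar (μx : XIdx k → ℝ) (x : ℤ → Ω → XIdx k → ℝ) (u : ℤ → Ω → Fin N → ℝ)
    (t : ℤ) (ω : Ω) : ZIdx k → ℝ :=
  Sum.elim (x t ω - μx) (u t ω)

/-- The dependent variables `y_{i,t} = α_i + x_{i,t}' β_i + u_{i,t}`. -/
def yProc (α : Fin N → ℝ) (β : XIdx k → ℝ) (x : ℤ → Ω → XIdx k → ℝ) (u : ℤ → Ω → Fin N → ℝ)
    (t : ℤ) (ω : Ω) (i : Fin N) : ℝ :=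
  α i + ∑ a : Fin (k i), x t ω ⟨i, a⟩ * β ⟨i, a⟩ + u t ω i

/-- The block-diagonal regressor matrix with the blocks `x_{1,t}, …, x_{N,t}`. -/
def XMat (x : ℤ → Ω → XIdx k → ℝ) (t : ℤ) (ω : Ω) : Matrix (XIdx k) (Fin N) ℝ :=
  Matrix.of fun a i => if a.1 = i then x t ω a else 0

/-- `Z_t`, the transpose of `[I_N, X_t']`. -/
def ZMat (x : ℤ → Ω → XIdx k → ℝ) (t : ℤ) (ω : Ω) : Matrix (Fin N ⊕ XIdx k) (Fin N) ℝ :=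
  Matrix.fromRows 1 (XMat x t ω)

/-- `E[Z_t Z_t']` is positive definite. -/
def Assumption2 (μ : Measure Ω) (x : ℤ → Ω → XIdx k → ℝ) : Prop :=
  ∀ t, (Matrix.of fun a b => ∫ ω, (ZMat x t ω * (ZMat x t ω).transpose) a b ∂μ).PosDef

/-- Error-block-diagonality: `Σ_xu = 0`; the coefficients `Ψ_j` are unrestricted. -/
def EBD (μ : Measure Ω) (Z : ℤ → Ω → ZIdx k → ℝ) : Prop :=
  ∀ t, (innovCov μ Z t).toBlocks₁₂ = 0

/-- GLS-exogeneity: `Ψ_{ux,j} = 0` for all `j`, and `Σ_xu = 0`. -/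
def GEXOG (μ : Measure Ω) (Z : ℤ → Ω → ZIdx k → ℝ) {p : ℕ}
    (Ψ : Fin p → Matrix (ZIdx k) (ZIdx k) ℝ) : Prop :=
  (∀ j, (Ψ j).toBlocks₂₁ = 0) ∧ ∀ t, (innovCov μ Z t).toBlocks₁₂ = 0

/-- Block-diagonality: `Ψ_{xu,j} = 0` and `Ψ_{ux,j} = 0` for all `j`, and `Σ_xu = 0`. -/
def BD (μ : Measure Ω) (Z : ℤ → Ω → ZIdx k → ℝ) {p : ℕ}
    (Ψ : Fin p → Matrix (ZIdx k) (ZIdx k) ℝ) : Prop :=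
  (∀ j, (Ψ j).toBlocks₁₂ = 0) ∧ (∀ j, (Ψ j).toBlocks₂₁ = 0) ∧
    ∀ t, (innovCov μ Z t).toBlocks₁₂ = 0

/-- Positions in the regressor vector of equation `i` of the augmented regression: the constant,
`x_{i,t}`, the `p` lags of `y_t`, the `p` lags of `x_t`. -/
abbrev WIdx (k : Fin N → ℕ) (p : ℕ) (i : Fin N) : Type :=
  Unit ⊕ Fin (k i) ⊕ (Fin p × Fin N) ⊕ (Fin p × XIdx k)

/-- The regressor vector
`w_{i,t} = (1, x_{i,t}', y_{t-1}', …, y_{t-p}', x_{t-1}', …, x_{t-p}')'`. -/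
def wVec (p : ℕ) (y : ℤ → Ω → Fin N → ℝ) (x : ℤ → Ω → XIdx k → ℝ) (i : Fin N)
    (t : ℤ) (ω : Ω) : WIdx k p i → ℝ :=
  Sum.elim (fun _ => 1) <| Sum.elim (fun a => x t ω ⟨i, a⟩) <|
    Sum.elim (fun jl => y (t - (jl.1 + 1)) ω jl.2) (fun ja => x (t - (ja.1 + 1)) ω ja.2)

/-- `B = blkdiag(β_1', …, β_N')`. -/
def BMat (β : XIdx k → ℝ) : Matrix (Fin N) (XIdx k) ℝ :=
  Matrix.of fun i a => if a.1 = i then β a else 0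

/-- The intercept `γ = (I - ∑_j Ψ_{uu,j}) α - ∑_j Ψ_{ux,j} μ_x`. -/
def gammaVec {p : ℕ} (α : Fin N → ℝ) (μx : XIdx k → ℝ)
    (Ψ : Fin p → Matrix (ZIdx k) (ZIdx k) ℝ) : Fin N → ℝ :=
  (1 - ∑ j, (Ψ j).toBlocks₂₂).mulVec α - (∑ j, (Ψ j).toBlocks₂₁).mulVec μx

/-- `Λ_j = Ψ_{ux,j} - Ψ_{uu,j} B`. -/
def LambdaMat {p : ℕ} (β : XIdx k → ℝ) (Ψ : Fin p → Matrix (ZIdx k) (ZIdx k) ℝ) (j : Fin p) :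
    Matrix (Fin N) (XIdx k) ℝ :=
  (Ψ j).toBlocks₂₁ - (Ψ j).toBlocks₂₂ * BMat β

/-- The parameter `θ_i = (γ_i, β_i', ψ_{uu,1,i}', …, ψ_{uu,p,i}', λ_{1,i}', …, λ_{p,i}')'`, where
`ψ_{uu,j,i}'` and `λ_{j,i}'` are the `i`-th rows of `Ψ_{uu,j}` and `Λ_j`. -/
def thetaVec {p : ℕ} (α : Fin N → ℝ) (β : XIdx k → ℝ) (μx : XIdx k → ℝ)
    (Ψ : Fin p → Matrix (ZIdx k) (ZIdx k) ℝ) (i : Fin N) : WIdx k p i → ℝ :=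
  Sum.elim (fun _ => gammaVec α μx Ψ i) <| Sum.elim (fun a => β ⟨i, a⟩) <|
    Sum.elim (fun jl => (Ψ jl.1).toBlocks₂₂ i jl.2) (fun ja => LambdaMat β Ψ ja.1 i ja.2)

/-- The sample second-moment matrix `(T - p)⁻¹ ∑_{t=p+1}^T w_{i,t} w_{i,t}'`. -/
def sampleGram (p : ℕ) (y : ℤ → Ω → Fin N → ℝ) (x : ℤ → Ω → XIdx k → ℝ) (i : Fin N)
    (T : ℕ) (ω : Ω) : Matrix (WIdx k p i) (WIdx k p i) ℝ :=
  ((T : ℝ) - p)⁻¹ • ∑ t ∈ Finset.Icc (p + 1) T,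
    Matrix.vecMulVec (wVec p y x i t ω) (wVec p y x i t ω)

/-- The equation-by-equation Durbin (OLS) estimator of `θ_i` on the sample `t = p+1, …, T`. -/
def thetaHat (p : ℕ) (y : ℤ → Ω → Fin N → ℝ) (x : ℤ → Ω → XIdx k → ℝ) (i : Fin N)
    (T : ℕ) (ω : Ω) : WIdx k p i → ℝ :=
  (sampleGram p y x i T ω)⁻¹.mulVec
    (((T : ℝ) - p)⁻¹ • ∑ t ∈ Finset.Icc (p + 1) T, y t ω i • wVec p y x i t ω)

end Model

end Durbin

end

/-!
Combinations of finitely many lags of `zbar` are limits, in `L²` and uniformly in time, of finite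
moving averages of the innovations: iterating the autoregression leaves a remainder which is a
projection onto the remote past. They are therefore near-epoch dependent on a strongly mixing
process, and the covariance inequality for such processes gives a law of large numbers for their
products, so that sample moments converge to population moments. The Gram matrix of the regressors
is nonsingular, since a vanishing combination of components of `zbar` would make the innovations at
its latest date linearly dependent. When `Σ_xu = 0`, the innovation of `u_i` is orthogonal to
`x_t` as well as to the past, hence to the regressors, so `θ_i` solves the population normal
equations.
-/

noncomputable section

namespace Durbin

/-! ### Cesàro means -/

section CesaroMean

variable {F : Type*} [NormedAddCommGroup F] [NormedSpace ℝ F]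

/-- The mean of the first `n` terms of a sequence (`0` for `n = 0`). -/
def cesaroMean (h : ℕ → F) (n : ℕ) : F :=
  (n : ℝ)⁻¹ • ∑ i ∈ Finset.range n, h i

lemma cesaroMean_add (g h : ℕ → F) : cesaroMean (g + h) = cesaroMean g + cesaroMean h := by
  ext n
  simp [cesaroMean, Finset.sum_add_distrib]

lemma cesaroMean_map {G : Type*} [NormedAddCommGroup G] [NormedSpace ℝ G] (L : F →L[ℝ] G)
    (h : ℕ → F) (n : ℕ) : cesaroMean (fun i => L (h i)) n = L (cesaroMean h n) := by
  simp [cesaroMean, map_sum]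

lemma norm_cesaroMean_le {h : ℕ → F} {r : ℝ} (hr : 0 ≤ r) (hh : ∀ i, ‖h i‖ ≤ r) (n : ℕ) :
    ‖cesaroMean h n‖ ≤ r := by
  rw [cesaroMean, norm_smul, norm_inv, Real.norm_natCast]
  refine inv_mul_le_of_le_mul₀ n.cast_nonneg hr ?_
  simpa using norm_sum_le_of_le (Finset.range n) fun i _ => hh i

lemma tendsto_cesaroMean_zero_of_approx {h : ℕ → F}
    (happrox : ∀ ε > 0, ∃ g : ℕ → F, (∀ i, ‖h i - g i‖ ≤ ε) ∧
      Tendsto (cesaroMean g) atTop (𝓝 0)) :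
    Tendsto (cesaroMean h) atTop (𝓝 0) := by
  refine NormedAddGroup.tendsto_nhds_zero.2 fun ε hε => ?_
  obtain ⟨g, hg, hlim⟩ := happrox (ε / 2) (half_pos hε)
  filter_upwards [NormedAddGroup.tendsto_nhds_zero.1 hlim (ε / 2) (half_pos hε)] with n hn
  calc ‖cesaroMean h n‖ = ‖cesaroMean (h - g) n + cesaroMean g n‖ := by
        rw [← Pi.add_apply, ← cesaroMean_add, sub_add_cancel]
    _ ≤ ‖cesaroMean (h - g) n‖ + ‖cesaroMean g n‖ := norm_add_le _ _
    _ < ε / 2 + ε / 2 := add_lt_add_of_le_of_lt (norm_cesaroMean_le (half_pos hε).le hg n) hn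
    _ = ε := add_halves ε

end CesaroMean

section HilbertLLN

variable {H : Type*} [NormedAddCommGroup H] [InnerProductSpace ℝ H] {h : ℕ → H} {a : ℕ → ℝ}

lemma norm_sum_range_sq_le (hha : ∀ i d, |inner ℝ (h i) (h (i + d))| ≤ a d) (n : ℕ) :
    ‖∑ i ∈ Finset.range n, h i‖ ^ 2
      ≤ 2 * ∑ m ∈ Finset.range n, ∑ d ∈ Finset.range (m + 1), a d := by
  induction n with
  | zero => simp
  | succ n ih =>
    have hinner : inner ℝ (∑ i ∈ Finset.range (n + 1), h i) (h n)
        ≤ ∑ d ∈ Finset.range (n + 1), a d := by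
      rw [sum_inner, ← Finset.sum_range_reflect a]
      refine Finset.sum_le_sum fun i hi => ?_
      have hin : i + (n - i) = n := Nat.add_sub_cancel' (Finset.mem_range_succ_iff.1 hi)
      simpa only [hin, add_tsub_cancel_right] using (le_abs_self _).trans (hha i (n - i))
    have hnorm := norm_sub_sq_real (∑ i ∈ Finset.range (n + 1), h i) (h n)
    rw [Finset.sum_range_succ, add_sub_cancel_right, ← Finset.sum_range_succ] at hnorm
    rw [Finset.sum_range_succ fun m => ∑ d ∈ Finset.range (m + 1), a d]
    linarith [sq_nonneg ‖h n‖]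

lemma norm_cesaroMean_sq_le (hha : ∀ i d, |inner ℝ (h i) (h (i + d))| ≤ a d) (n : ℕ) :
    ‖cesaroMean h n‖ ^ 2 ≤ 2 * cesaroMean (fun m => cesaroMean a (m + 1)) n := by
  have ha : ∀ d, 0 ≤ a d := fun d => (abs_nonneg _).trans (hha 0 d)
  have hterm : ∀ m ∈ Finset.range n,
      ∑ d ∈ Finset.range (m + 1), a d ≤ n * cesaroMean a (m + 1) := fun m hm => by
    have hmn : ((m + 1 : ℕ) : ℝ) ≤ n := by exact_mod_cast Finset.mem_range.1 hm
    calc ∑ d ∈ Finset.range (m + 1), a d = (m + 1 : ℕ) * cesaroMean a (m + 1) := by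
          rw [cesaroMean, smul_eq_mul, mul_inv_cancel_left₀ (by positivity)]
      _ ≤ n * cesaroMean a (m + 1) :=
          mul_le_mul_of_nonneg_right hmn
            (mul_nonneg (by positivity) (Finset.sum_nonneg fun d _ => ha d))
  rcases n.eq_zero_or_pos with rfl | hn
  · simp [cesaroMean]
  calc ‖cesaroMean h n‖ ^ 2 = (n : ℝ)⁻¹ ^ 2 * ‖∑ i ∈ Finset.range n, h i‖ ^ 2 := by
        rw [cesaroMean, norm_smul, mul_pow, norm_inv, Real.norm_natCast]
    _ ≤ (n : ℝ)⁻¹ ^ 2 * (2 * ∑ m ∈ Finset.range n, n * cesaroMean a (m + 1)) := by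
        gcongr
        exact (norm_sum_range_sq_le hha n).trans
          (mul_le_mul_of_nonneg_left (Finset.sum_le_sum hterm) two_pos.le)
    _ = 2 * cesaroMean (fun m => cesaroMean a (m + 1)) n := by
        rw [← Finset.mul_sum, cesaroMean, smul_eq_mul]
        field_simp

theorem tendsto_cesaroMean_zero_of_inner_le (ha : Tendsto a atTop (𝓝 0))
    (hha : ∀ i d, |inner ℝ (h i) (h (i + d))| ≤ a d) :
    Tendsto (cesaroMean h) atTop (𝓝 0) := by
  have hbound : Tendsto (fun n => 2 * cesaroMean (fun m => cesaroMean a (m + 1)) n) atTop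
      (𝓝 0) := by
    simpa [cesaroMean] using (ha.cesaro_smul.comp (tendsto_add_atTop_nat 1)).cesaro_smul.const_mul 2
  have hsq := squeeze_zero (fun n => sq_nonneg _) (norm_cesaroMean_sq_le hha) hbound
  exact tendsto_zero_iff_norm_tendsto_zero.2
    (by simpa [Real.sqrt_sq] using hsq.sqrt)

end HilbertLLN

/-! ### Strong mixing -/

section Mixing

open ProbabilityTheory

variable {Ω : Type*} {mΩ : MeasurableSpace Ω} {μ : Measure Ω}

lemma integral_abs_le_of_setIntegral_le {m : MeasurableSpace Ω} (hm : m ≤ mΩ) {g : Ω → ℝ} {c : ℝ}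
    (hg : StronglyMeasurable[m] g) (hgi : Integrable g μ)
    (hc : ∀ A, MeasurableSet[m] A → |∫ ω in A, g ω ∂μ| ≤ c) : ∫ ω, |g ω| ∂μ ≤ 2 * c := by
  have hA : MeasurableSet[m] {ω | 0 ≤ g ω} := measurableSet_le measurable_const hg.measurable
  have hpos : ∫ ω in {ω | 0 ≤ g ω}, |g ω| ∂μ = ∫ ω in {ω | 0 ≤ g ω}, g ω ∂μ :=
    setIntegral_congr_fun (hm _ hA) fun ω hω => abs_of_nonneg hω
  have hneg : ∫ ω in {ω | 0 ≤ g ω}ᶜ, |g ω| ∂μ = -∫ ω in {ω | 0 ≤ g ω}ᶜ, g ω ∂μ := by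
    rw [← integral_neg]
    exact setIntegral_congr_fun (hm _ hA).compl fun ω hω => abs_of_neg (not_le.1 hω)
  rw [← integral_add_compl (hm _ hA) hgi.abs, hpos, hneg]
  linarith [(abs_le.1 (hc _ hA)).2, (abs_le.1 (hc _ hA.compl)).1]

/-- Conditioning on `m` replaces `Y` by an `m`-measurable variable. -/
lemma abs_integral_mul_le_of_setIntegral_le [IsFiniteMeasure μ] {m : MeasurableSpace Ω}
    (hm : m ≤ mΩ) {X Y : Ω → ℝ} {M c : ℝ} (hX : Measurable[m] X) (hM : 0 ≤ M)
    (hXM : ∀ ω, |X ω| ≤ M) (hY : Integrable Y μ)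
    (hc : ∀ A, MeasurableSet[m] A → |∫ ω in A, Y ω ∂μ| ≤ c) :
    |∫ ω, X ω * Y ω ∂μ| ≤ M * (2 * c) := by
  have hXm : StronglyMeasurable[m] X := hX.stronglyMeasurable
  have hXY : Integrable (X * Y) μ :=
    hY.bdd_mul (hXm.mono hm).aestronglyMeasurable (ae_of_all _ hXM)
  have hcond : ∫ ω, X ω * Y ω ∂μ = ∫ ω, X ω * μ[Y | m] ω ∂μ := by
    rw [← Pi.mul_def, ← integral_condExp hm]
    exact integral_congr_ae (condExp_mul_of_stronglyMeasurable_left hXm hXY hY)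
  have hset : ∀ A, MeasurableSet[m] A → |∫ ω in A, μ[Y | m] ω ∂μ| ≤ c := fun A hA => by
    simpa only [setIntegral_condExp hm hY hA] using hc A hA
  calc |∫ ω, X ω * Y ω ∂μ| ≤ ∫ ω, |X ω * μ[Y | m] ω| ∂μ := hcond ▸ abs_integral_le_integral_abs
    _ ≤ ∫ ω, M * |μ[Y | m] ω| ∂μ := by
        refine integral_mono_of_nonneg (ae_of_all _ fun _ => abs_nonneg _)
          (integrable_condExp.abs.const_mul M) (ae_of_all _ fun ω => ?_)
        simpa only [abs_mul] using mul_le_mul_of_nonneg_right (hXM ω) (abs_nonneg _)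
    _ = M * ∫ ω, |μ[Y | m] ω| ∂μ := integral_const_mul _ _
    _ ≤ M * (2 * c) := by
        gcongr
        exact integral_abs_le_of_setIntegral_le hm stronglyMeasurable_condExp integrable_condExp
          hset

variable [IsProbabilityMeasure μ]

lemma covariance_eq_integral_mul_sub {X Y : Ω → ℝ} (hX : MemLp X 2 μ) (hY : MemLp Y 2 μ) :
    cov[X, Y; μ] = ∫ ω, X ω * (Y ω - μ[Y]) ∂μ := by
  have hXY : Integrable (fun ω => X ω * Y ω) μ := hX.integrable_mul hY
  simp only [covariance_eq_sub hX hY, mul_sub, Pi.mul_apply]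
  rw [integral_sub hXY ((hX.integrable one_le_two).mul_const _), integral_mul_const]

lemma memLp_indicator_one {A : Set Ω} (hA : MeasurableSet A) (q : ℝ≥0∞) :
    MemLp (A.indicator (1 : Ω → ℝ)) q μ :=
  (memLp_const (1 : ℝ)).indicator hA

lemma covariance_indicator_one_left {A : Set Ω} (hA : MeasurableSet A) {Y : Ω → ℝ}
    (hY : MemLp Y 2 μ) : cov[A.indicator 1, Y; μ] = ∫ ω in A, (Y ω - μ[Y]) ∂μ := by
  rw [covariance_eq_integral_mul_sub (memLp_indicator_one hA 2) hY,
    ← integral_indicator hA]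
  congr 1 with ω
  by_cases hω : ω ∈ A <;> simp [hω]

lemma covariance_indicator_one {A B : Set Ω} (hA : MeasurableSet A) (hB : MeasurableSet B) :
    cov[A.indicator 1, B.indicator (1 : Ω → ℝ); μ] = μ.real (A ∩ B) - μ.real A * μ.real B := by
  rw [covariance_eq_sub (memLp_indicator_one hA 2) (memLp_indicator_one hB 2),
    ← Set.inter_indicator_one, integral_indicator_one hA, integral_indicator_one hB,
    integral_indicator_one (hA.inter hB)]

lemma abs_covariance_le_of_indicator {m : MeasurableSpace Ω} (hm : m ≤ mΩ) {X Y : Ω → ℝ}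
    {M c : ℝ} (hX : Measurable[m] X) (hM : 0 ≤ M) (hXM : ∀ ω, |X ω| ≤ M) (hY : MemLp Y 2 μ)
    (hc : ∀ A, MeasurableSet[m] A → |cov[A.indicator 1, Y; μ]| ≤ c) :
    |cov[X, Y; μ]| ≤ 2 * M * c := by
  have hX2 : MemLp X 2 μ := .of_bound (hX.mono hm le_rfl).aestronglyMeasurable M (ae_of_all _ hXM)
  rw [covariance_eq_integral_mul_sub hX2 hY, mul_comm 2, mul_assoc]
  refine abs_integral_mul_le_of_setIntegral_le hm hX hM hXM
    ((hY.integrable one_le_two).sub (integrable_const _)) fun A hA => ?_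
  rw [← covariance_indicator_one_left (hm _ hA) hY]
  exact hc A hA

theorem abs_covariance_le_of_mixing {m₁ m₂ : MeasurableSpace Ω} (hm₁ : m₁ ≤ mΩ) (hm₂ : m₂ ≤ mΩ)
    {X Y : Ω → ℝ} {M a : ℝ} (hX : Measurable[m₁] X) (hY : Measurable[m₂] Y) (hM : 0 ≤ M)
    (hXM : ∀ ω, |X ω| ≤ M) (hYM : ∀ ω, |Y ω| ≤ M)
    (ha : ∀ A B, MeasurableSet[m₁] A → MeasurableSet[m₂] B →
      |μ.real (A ∩ B) - μ.real A * μ.real B| ≤ a) :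
    |cov[X, Y; μ]| ≤ 4 * M ^ 2 * a := by
  have hY2 : MemLp Y 2 μ := .of_bound (hY.mono hm₂ le_rfl).aestronglyMeasurable M (ae_of_all _ hYM)
  have hYA : ∀ A, MeasurableSet[m₁] A → |cov[A.indicator 1, Y; μ]| ≤ 2 * M * a := fun A hA => by
    rw [covariance_comm]
    refine abs_covariance_le_of_indicator hm₂ hY hM hYM
      (memLp_indicator_one (hm₁ _ hA) 2) fun B hB => ?_
    rw [covariance_comm, covariance_indicator_one (hm₁ _ hA) (hm₂ _ hB)]
    exact ha A B hA hB
  calc |cov[X, Y; μ]| ≤ 2 * M * (2 * M * a) :=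
        abs_covariance_le_of_indicator hm₁ hX hM hXM hY2 hYA
    _ = 4 * M ^ 2 * a := by ring

lemma abs_measureReal_inter_sub_mul_le_one (A B : Set Ω) :
    |μ.real (A ∩ B) - μ.real A * μ.real B| ≤ 1 :=
  abs_sub_le_of_nonneg_of_le measureReal_nonneg measureReal_le_one
    (mul_nonneg measureReal_nonneg measureReal_nonneg)
    (mul_le_one₀ measureReal_le_one measureReal_nonneg measureReal_le_one)

end Mixing

section AlphaMix

variable {Ω : Type*} {ι : Type*}

lemma sigmaOf_le [mΩ : MeasurableSpace Ω] {V : ℤ → Ω → ι → ℝ} (hV : ∀ t, Measurable (V t))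
    (S : Set ℤ) : sigmaOf V S ≤ mΩ :=
  iSup₂_le fun s _ => (hV s).comap_le

lemma sigmaOf_mono (V : ℤ → Ω → ι → ℝ) : Monotone (sigmaOf V) :=
  fun _ _ h => biSup_mono h

lemma sigmaOf_Icc_mono (V : ℤ → Ω → ι → ℝ) {w w' : ℕ} (h : w ≤ w') (t : ℤ) :
    sigmaOf V (Set.Icc (t - w) t) ≤ sigmaOf V (Set.Icc (t - w') t) :=
  sigmaOf_mono V (Set.Icc_subset_Icc_left (by lia))

lemma measurable_sigmaOf (V : ℤ → Ω → ι → ℝ) {S : Set ℤ} {s : ℤ} (hs : s ∈ S) :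
    Measurable[sigmaOf V S] (V s) :=
  (comap_measurable (V s)).mono
    (le_biSup (fun s => MeasurableSpace.comap (V s) inferInstance) hs) le_rfl

variable [mΩ : MeasurableSpace Ω] (μ : Measure Ω) [IsProbabilityMeasure μ] (V : ℤ → Ω → ι → ℝ)
  {A B : Set Ω} {t : ℤ}

lemma abs_measureReal_inter_sub_mul_le_alphaMix {l : ℕ}
    (hA : MeasurableSet[sigmaOf V (Set.Iic (t - l))] A)
    (hB : MeasurableSet[sigmaOf V (Set.Ici t)] B) :
    |μ.real (A ∩ B) - μ.real A * μ.real B| ≤ alphaMix μ V l := by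
  refine le_csSup ⟨1, ?_⟩ ⟨t, A, B, hA, hB, rfl⟩
  rintro r ⟨-, A, B, -, -, rfl⟩
  exact abs_measureReal_inter_sub_mul_le_one A B

/-- Windows of length `w` at lag `d` overlap when `d < w`; only the trivial bound is left then. -/
lemma abs_measureReal_inter_sub_mul_le_of_window {w d : ℕ}
    (hA : MeasurableSet[sigmaOf V (Set.Icc (t - w) t)] A)
    (hB : MeasurableSet[sigmaOf V (Set.Icc (t + d - w) (t + d))] B) :
    |μ.real (A ∩ B) - μ.real A * μ.real B| ≤ if d < w then 1 else alphaMix μ V (d - w) := by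
  split_ifs with hd
  · exact abs_measureReal_inter_sub_mul_le_one A B
  · refine abs_measureReal_inter_sub_mul_le_alphaMix μ V (t := t + d - w)
      (sigmaOf_mono V (fun s hs => ?_) _ hA) (sigmaOf_mono V Set.Icc_subset_Ici_self _ hB)
    simp only [Set.mem_Icc, Set.mem_Iic] at hs ⊢
    omega

end AlphaMix

/-! ### Products of square-integrable variables -/

section CentredMul

variable {Ω : Type*} [mΩ : MeasurableSpace Ω] {μ : Measure Ω}

lemma coeFn_cesaroMean {q : ℝ≥0∞} [Fact (1 ≤ q)] (h : ℕ → Lp ℝ q μ) (n : ℕ) :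
    (cesaroMean h n : Lp ℝ q μ) =ᵐ[μ] fun ω => cesaroMean (fun i => h i ω) n := by
  filter_upwards [Lp.coeFn_smul (n : ℝ)⁻¹ (∑ i ∈ Finset.range n, h i),
    Lp.coeFn_fun_finsetSum (Finset.range n) h] with ω hsmul hsum
  rw [cesaroMean, hsmul, Pi.smul_apply, hsum, cesaroMean]

lemma inner_eq_integral_of_ae {f g : Lp ℝ 2 μ} {F G : Ω → ℝ} (hf : f =ᵐ[μ] F) (hg : g =ᵐ[μ] G) :
    inner ℝ f g = ∫ ω, F ω * G ω ∂μ := by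
  rw [L2.inner_def]
  refine integral_congr_ae ?_
  filter_upwards [hf, hg] with ω hfω hgω
  simp [hfω, hgω, mul_comm]

variable [IsProbabilityMeasure μ]

/-- The inclusion of `L²` into `L¹`, as multiplication by the square-integrable constant `1`. -/
def toL1 (μ : Measure Ω) [IsProbabilityMeasure μ] : Lp ℝ 2 μ →L[ℝ] Lp ℝ 1 μ :=
  ((ContinuousLinearMap.mul ℝ ℝ).holderL μ 2 2 1).flip (Lp.const 2 μ 1)

lemma coeFn_toL1 (f : Lp ℝ 2 μ) : toL1 μ f =ᵐ[μ] f := by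
  have hmul : toL1 μ f =ᵐ[μ] fun ω => f ω * Lp.const 2 μ (1 : ℝ) ω :=
    (ContinuousLinearMap.mul ℝ ℝ).coeFn_holder f (Lp.const 2 μ (1 : ℝ))
  filter_upwards [hmul, Lp.coeFn_const 2 μ (1 : ℝ)] with ω hω hone
  rw [hω, hone, Function.const_apply, mul_one]

/-- The product of two square-integrable variables, minus its mean. -/
def centredMul (f g : Lp ℝ 2 μ) : Lp ℝ 1 μ :=
  (ContinuousLinearMap.mul ℝ ℝ).holder 1 f g - Lp.const 1 μ (inner ℝ f g)

lemma coeFn_centredMul (f g : Lp ℝ 2 μ) :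
    centredMul f g =ᵐ[μ] fun ω => f ω * g ω - inner ℝ f g := by
  filter_upwards [Lp.coeFn_sub ((ContinuousLinearMap.mul ℝ ℝ).holder 1 f g)
      (Lp.const 1 μ (inner ℝ f g)), (ContinuousLinearMap.mul ℝ ℝ).coeFn_holder (r := 1) f g,
    Lp.coeFn_const 1 μ (inner ℝ f g : ℝ)] with ω hsub hmul hconst
  rw [centredMul, hsub, Pi.sub_apply, hmul, hconst, ContinuousLinearMap.mul_apply']
  rfl

lemma centredMul_comm (f g : Lp ℝ 2 μ) : centredMul f g = centredMul g f := by
  refine Lp.ext ?_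
  filter_upwards [coeFn_centredMul f g, coeFn_centredMul g f] with ω hfg hgf
  rw [hfg, hgf, mul_comm, real_inner_comm]

lemma centredMul_sub_left (f f' g : Lp ℝ 2 μ) :
    centredMul (f - f') g = centredMul f g - centredMul f' g := by
  have hmul : (ContinuousLinearMap.mul ℝ ℝ).holder 1 (f - f') g
      = (ContinuousLinearMap.mul ℝ ℝ).holder 1 f g - (ContinuousLinearMap.mul ℝ ℝ).holder 1 f' g :=
    congrArg (· g) (map_sub ((ContinuousLinearMap.mul ℝ ℝ).holderL μ 2 2 1) f f')
  rw [centredMul, centredMul, centredMul, hmul, inner_sub_left, map_sub]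
  abel

lemma norm_centredMul_le (f g : Lp ℝ 2 μ) : ‖centredMul f g‖ ≤ 2 * (‖f‖ * ‖g‖) := by
  have hmul : ‖(ContinuousLinearMap.mul ℝ ℝ).holder 1 f g‖ ≤ ‖f‖ * ‖g‖ := by
    simpa using (ContinuousLinearMap.mul ℝ ℝ).norm_holder_apply_apply_le (r := 1) f g
  have hconst : ‖Lp.const 1 μ (inner ℝ f g : ℝ)‖ ≤ ‖f‖ * ‖g‖ := by
    simpa [Lp.norm_const'] using norm_inner_le_norm (𝕜 := ℝ) f g
  rw [two_mul]
  exact (norm_sub_le _ _).trans (add_le_add hmul hconst)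

end CentredMul

section UniformClosure

variable {T H : Type*} [SeminormedAddCommGroup H] [NormedSpace ℝ H]

/-- The closure of a space of functions under uniform approximation. -/
def uniformClosure (S : Submodule ℝ (T → H)) : Submodule ℝ (T → H) where
  carrier := {f | ∀ ε > 0, ∃ g ∈ S, ∀ t, ‖f t - g t‖ ≤ ε}
  zero_mem' ε hε := ⟨0, S.zero_mem, fun t => by simpa using hε.le⟩
  add_mem' {f f'} hf hf' ε hε := by
    obtain ⟨g, hg, hfg⟩ := hf (ε / 2) (half_pos hε)
    obtain ⟨g', hg', hfg'⟩ := hf' (ε / 2) (half_pos hε)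
    refine ⟨g + g', S.add_mem hg hg', fun t => ?_⟩
    rw [Pi.add_apply, Pi.add_apply, add_sub_add_comm]
    exact (norm_add_le_of_le (hfg t) (hfg' t)).trans_eq (add_halves ε)
  smul_mem' c f hf ε hε := by
    obtain ⟨g, hg, hfg⟩ := hf (ε / (‖c‖ + 1)) (by positivity)
    refine ⟨c • g, S.smul_mem c hg, fun t => ?_⟩
    rw [Pi.smul_apply, Pi.smul_apply, ← smul_sub, norm_smul]
    calc ‖c‖ * ‖f t - g t‖ ≤ (‖c‖ + 1) * (ε / (‖c‖ + 1)) := by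
          gcongr
          · linarith
          · exact hfg t
      _ = ε := by field_simp

lemma le_uniformClosure (S : Submodule ℝ (T → H)) : S ≤ uniformClosure S :=
  fun f hf ε hε => ⟨f, hf, fun t => by simpa using hε.le⟩

lemma uniformClosure_le {S S' : Submodule ℝ (T → H)} (h : S ≤ uniformClosure S') :
    uniformClosure S ≤ uniformClosure S' := fun f hf ε hε => by
  obtain ⟨g, hg, hfg⟩ := hf (ε / 2) (half_pos hε)
  obtain ⟨g', hg', hgg'⟩ := h hg (ε / 2) (half_pos hε)
  exact ⟨g', hg', fun t =>
    (norm_sub_le_norm_sub_add_norm_sub _ (g t) _).trans (by linarith [hfg t, hgg' t])⟩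

end UniformClosure

/-! ### Near-epoch dependence -/

section NearEpoch

open ProbabilityTheory

variable {Ω : Type*} {ι : Type*} [mΩ : MeasurableSpace Ω] {μ : Measure Ω}

/-- The processes given by bounded functions of the window `V (t - w), …, V t`, for some length `w`
and some bound that do not depend on `t`. -/
def windowProcesses (μ : Measure Ω) (V : ℤ → Ω → ι → ℝ) : Submodule ℝ (ℤ → Lp ℝ 2 μ) where
  carrier := {f | ∃ (w : ℕ) (M : ℝ) (v : ℤ → Ω → ℝ), 0 ≤ M ∧
    ∀ t, Measurable[sigmaOf V (Set.Icc (t - w) t)] (v t) ∧ (∀ ω, |v t ω| ≤ M) ∧ f t =ᵐ[μ] v t}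
  zero_mem' := ⟨0, 0, 0, le_rfl, fun t => ⟨measurable_const, by simp, Lp.coeFn_zero ℝ 2 μ⟩⟩
  add_mem' := by
    rintro f f' ⟨w, M, v, hM, hv⟩ ⟨w', M', v', hM', hv'⟩
    refine ⟨max w w', M + M', v + v', add_nonneg hM hM', fun t => ⟨?_, fun ω => ?_, ?_⟩⟩
    · exact Measurable.add ((hv t).1.mono (sigmaOf_Icc_mono V (le_max_left _ _) t) le_rfl)
        ((hv' t).1.mono (sigmaOf_Icc_mono V (le_max_right _ _) t) le_rfl)
    · exact (abs_add_le _ _).trans (add_le_add ((hv t).2.1 ω) ((hv' t).2.1 ω))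
    · exact (Lp.coeFn_add _ _).trans ((hv t).2.2.add (hv' t).2.2)
  smul_mem' := by
    rintro c f ⟨w, M, v, hM, hv⟩
    refine ⟨w, |c| * M, c • v, mul_nonneg (abs_nonneg c) hM, fun t => ⟨?_, fun ω => ?_, ?_⟩⟩
    · exact Measurable.const_smul (hv t).1 c
    · simpa [abs_mul] using mul_le_mul_of_nonneg_left ((hv t).2.1 ω) (abs_nonneg c)
    · exact (Lp.coeFn_smul _ _).trans ((hv t).2.2.const_smul c)

/-- The processes that are near-epoch dependent on `V`: uniform `L²`-limits of bounded functions of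
finite windows of `V`. -/
def nearEpochDependent (μ : Measure Ω) (V : ℤ → Ω → ι → ℝ) : Submodule ℝ (ℤ → Lp ℝ 2 μ) :=
  uniformClosure (windowProcesses μ V)

variable [IsProbabilityMeasure μ] {V : ℤ → Ω → ι → ℝ}

lemma tendsto_cesaroMean_sub_integral (hV : ∀ t, Measurable (V t))
    (hα : Tendsto (alphaMix μ V) atTop (𝓝 0)) {v : ℤ → Ω → ℝ} {w : ℕ} {M : ℝ} (hM : 0 ≤ M)
    (hv : ∀ t, Measurable[sigmaOf V (Set.Icc (t - w) t)] (v t)) (hvM : ∀ t ω, |v t ω| ≤ M)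
    {g : ℤ → Lp ℝ 2 μ} (hg : ∀ t, g t =ᵐ[μ] fun ω => v t ω - μ[v t]) (c : ℤ) :
    Tendsto (cesaroMean fun i => g (c + i)) atTop (𝓝 0) := by
  refine tendsto_cesaroMean_zero_of_inner_le
    (a := fun d => 4 * M ^ 2 * if d < w then 1 else alphaMix μ V (d - w)) ?_ fun i d => ?_
  · suffices Tendsto (fun d => 4 * M ^ 2 * alphaMix μ V (d - w)) atTop (𝓝 0) from
      this.congr' ((eventually_ge_atTop w).mono fun d hd => by simp [not_lt.2 hd])
    simpa using (hα.comp (tendsto_sub_atTop_nat w)).const_mul (4 * M ^ 2)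
  · have hcov : inner ℝ (g (c + i)) (g (c + (i + d : ℕ))) = cov[v (c + i), v (c + i + d); μ] := by
      rw [Nat.cast_add, ← add_assoc]
      exact inner_eq_integral_of_ae (hg _) (hg _)
    rw [hcov]
    exact abs_covariance_le_of_mixing (sigmaOf_le hV _) (sigmaOf_le hV _) (hv _) (hv _) hM
      (hvM _) (hvM _) fun A B hA hB => abs_measureReal_inter_sub_mul_le_of_window μ V hA hB

lemma tendsto_cesaroMean_centredMul_of_mem_windowProcesses (hV : ∀ t, Measurable (V t))
    (hα : Tendsto (alphaMix μ V) atTop (𝓝 0)) {f g : ℤ → Lp ℝ 2 μ}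
    (hf : f ∈ windowProcesses μ V) (hg : g ∈ windowProcesses μ V) (c : ℤ) :
    Tendsto (cesaroMean fun i => centredMul (f (c + i)) (g (c + i))) atTop (𝓝 0) := by
  obtain ⟨w, M, v, hM, hv⟩ := hf
  obtain ⟨w', M', v', hM', hv'⟩ := hg
  have hmeas : ∀ t, Measurable[sigmaOf V (Set.Icc (t - (max w w' : ℕ)) t)] (v t * v' t) := fun t =>
    Measurable.mul ((hv t).1.mono (sigmaOf_Icc_mono V (le_max_left _ _) t) le_rfl)
      ((hv' t).1.mono (sigmaOf_Icc_mono V (le_max_right _ _) t) le_rfl)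
  have hbound : ∀ t ω, |(v t * v' t) ω| ≤ M * M' := fun t ω => by
    rw [Pi.mul_apply, abs_mul]
    exact mul_le_mul ((hv t).2.1 ω) ((hv' t).2.1 ω) (abs_nonneg _) hM
  have hL2 : ∀ t, MemLp (fun ω => (v t * v' t) ω - μ[v t * v' t]) 2 μ := fun t =>
    (MemLp.of_bound ((hmeas t).mono (sigmaOf_le hV _) le_rfl).aestronglyMeasurable (M * M')
      (ae_of_all _ (hbound t))).sub (memLp_const _)
  have htoL1 : ∀ t, toL1 μ ((hL2 t).toLp _) = centredMul (f t) (g t) := fun t => by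
    refine Lp.ext ?_
    filter_upwards [coeFn_toL1 ((hL2 t).toLp _), (hL2 t).coeFn_toLp, coeFn_centredMul (f t) (g t),
      (hv t).2.2, (hv' t).2.2] with ω h₁ h₂ h₃ h₄ h₅
    rw [h₁, h₂, h₃, h₄, h₅, inner_eq_integral_of_ae (hv t).2.2 (hv' t).2.2]
    rfl
  have hlim := tendsto_cesaroMean_sub_integral hV hα (mul_nonneg hM hM') hmeas hbound
    (fun t => (hL2 t).coeFn_toLp) c
  simpa only [Function.comp_def, ← cesaroMean_map, htoL1, map_zero] using
    ((toL1 μ).continuous.tendsto 0).comp hlim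

lemma tendsto_cesaroMean_centredMul_of_mem_uniformClosure {S : Submodule ℝ (ℤ → Lp ℝ 2 μ)}
    {f g : ℤ → Lp ℝ 2 μ} {C : ℝ} (hC : ∀ t, ‖g t‖ ≤ C) {c : ℤ}
    (hS : ∀ f ∈ S, Tendsto (cesaroMean fun i => centredMul (f (c + i)) (g (c + i))) atTop (𝓝 0))
    (hf : f ∈ uniformClosure S) :
    Tendsto (cesaroMean fun i => centredMul (f (c + i)) (g (c + i))) atTop (𝓝 0) := by
  refine tendsto_cesaroMean_zero_of_approx fun ε hε => ?_
  have hC0 : 0 ≤ C := (norm_nonneg _).trans (hC 0)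
  obtain ⟨f', hf', hff'⟩ := hf (ε / (2 * (C + 1))) (by positivity)
  refine ⟨_, fun i => ?_, hS f' hf'⟩
  rw [← centredMul_sub_left]
  calc ‖centredMul (f (c + i) - f' (c + i)) (g (c + i))‖
      ≤ 2 * (‖f (c + i) - f' (c + i)‖ * ‖g (c + i)‖) := norm_centredMul_le _ _
    _ ≤ 2 * (ε / (2 * (C + 1)) * (C + 1)) := by
        gcongr
        · exact hff' _
        · linarith [hC (c + i)]
    _ = ε := by field_simp

lemma exists_norm_le_of_mem_nearEpochDependent {f : ℤ → Lp ℝ 2 μ}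
    (hf : f ∈ nearEpochDependent μ V) : ∃ C, ∀ t, ‖f t‖ ≤ C := by
  obtain ⟨g, ⟨w, M, v, hM, hv⟩, hfg⟩ := hf 1 one_pos
  have hg : ∀ t, ‖g t‖ ≤ M := fun t => by
    refine (Lp.norm_le_of_ae_bound hM ((hv t).2.2.mono fun ω hω => ?_)).trans_eq ?_
    · exact hω ▸ (hv t).2.1 ω
    · simp [measureUnivNNReal]
  exact ⟨1 + M, fun t => (norm_le_norm_sub_add _ (g t)).trans (add_le_add (hfg t) (hg t))⟩

theorem tendsto_cesaroMean_centredMul (hV : ∀ t, Measurable (V t))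
    (hα : Tendsto (alphaMix μ V) atTop (𝓝 0)) {f g : ℤ → Lp ℝ 2 μ}
    (hf : f ∈ nearEpochDependent μ V) (hg : g ∈ nearEpochDependent μ V) (c : ℤ) :
    Tendsto (cesaroMean fun i => centredMul (f (c + i)) (g (c + i))) atTop (𝓝 0) := by
  obtain ⟨C, hC⟩ := exists_norm_le_of_mem_nearEpochDependent hg
  refine tendsto_cesaroMean_centredMul_of_mem_uniformClosure hC (fun f' hf' => ?_) hf
  obtain ⟨C', hC'⟩ :=
    exists_norm_le_of_mem_nearEpochDependent (le_uniformClosure (windowProcesses μ V) hf')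
  simp only [centredMul_comm (f' _)]
  refine tendsto_cesaroMean_centredMul_of_mem_uniformClosure hC' (fun g' hg' => ?_) hg
  exact tendsto_cesaroMean_centredMul_of_mem_windowProcesses hV hα hg' hf' c

theorem tendstoInMeasure_cesaroMean_mul (hV : ∀ t, Measurable (V t))
    (hα : Tendsto (alphaMix μ V) atTop (𝓝 0)) {f g : ℤ → Lp ℝ 2 μ}
    (hf : f ∈ nearEpochDependent μ V) (hg : g ∈ nearEpochDependent μ V) {F G : ℤ → Ω → ℝ}
    (hfF : ∀ t, f t =ᵐ[μ] F t) (hgG : ∀ t, g t =ᵐ[μ] G t) {q : ℝ}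
    (hq : ∀ t, inner ℝ (f t) (g t) = q) (c : ℤ) :
    TendstoInMeasure μ (fun n ω => cesaroMean (fun i => F (c + i) ω * G (c + i) ω) n) atTop
      fun _ => q := by
  have hlim : TendstoInMeasure μ
      (fun n => (cesaroMean (fun i : ℕ => centredMul (f (c + i)) (g (c + i))) n : Lp ℝ 1 μ))
      atTop (0 : Lp ℝ 1 μ) :=
    tendstoInMeasure_of_tendsto_Lp (tendsto_cesaroMean_centredMul hV hα hf hg c)
  rw [tendstoInMeasure_iff_norm] at hlim ⊢
  refine fun ε hε => (hlim ε hε).congr' ?_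
  filter_upwards [eventually_ne_atTop 0] with n hn
  have hterm : ∀ᵐ ω ∂μ, ∀ i : ℕ, centredMul (f (c + i)) (g (c + i)) ω
      = F (c + i) ω * G (c + i) ω - q := by
    refine ae_all_iff.2 fun i => ?_
    filter_upwards [coeFn_centredMul (f (c + i)) (g (c + i)), hfF (c + i), hgG (c + i)]
      with ω hmul hF hG
    rw [hmul, hF, hG, hq]
  refine measure_congr ?_
  filter_upwards [hterm, coeFn_cesaroMean (fun i : ℕ => centredMul (f (c + i)) (g (c + i))) n,
    Lp.coeFn_zero ℝ 1 μ] with ω hω hmean hzero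
  refine congrArg (ε ≤ ‖·‖) ?_
  rw [hmean, hzero, funext hω, Pi.zero_apply, sub_zero]
  simp [cesaroMean, mul_sub, hn]

end NearEpoch

section Truncation

variable {Ω : Type*} [mΩ : MeasurableSpace Ω] {μ : Measure Ω}

lemma enorm_rpow_le_mul_enorm_rpow {E : Type*} [NormedAddCommGroup E] {K p q : ℝ} (hK : 0 < K)
    (hpq : p ≤ q) {y : E} (hy : K ≤ ‖y‖) :
    ‖y‖ₑ ^ p ≤ ENNReal.ofReal (K ^ (p - q)) * ‖y‖ₑ ^ q := by
  have hy0 : 0 < ‖y‖ := hK.trans_le hy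
  rw [← ofReal_norm, ENNReal.ofReal_rpow_of_pos hy0, ENNReal.ofReal_rpow_of_pos hy0,
    ← ENNReal.ofReal_mul (by positivity)]
  refine ENNReal.ofReal_le_ofReal ?_
  calc ‖y‖ ^ p = ‖y‖ ^ (p - q) * ‖y‖ ^ q := by rw [← Real.rpow_add hy0, sub_add_cancel]
    _ ≤ K ^ (p - q) * ‖y‖ ^ q := by
        gcongr ?_ * _
        exact Real.rpow_le_rpow_of_nonpos hK hy (sub_nonpos.2 hpq)

lemma uniformIntegrable_of_lintegral_rpow_le [IsFiniteMeasure μ] {T E : Type*}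
    [NormedAddCommGroup E] {f : T → Ω → E} (hf : ∀ t, AEStronglyMeasurable (f t) μ) {p q : ℝ}
    (hp : 1 ≤ p) (hpq : p < q) {C : ℝ≥0} (hC : ∀ t, ∫⁻ ω, ‖f t ω‖ₑ ^ q ∂μ ≤ C) :
    UniformIntegrable f (ENNReal.ofReal p) μ := by
  have hp0 : 0 < p := one_pos.trans_le hp
  refine uniformIntegrable_of (by simpa using hp) ENNReal.ofReal_ne_top hf fun ε hε => ?_
  have hlim : Tendsto (fun K : ℝ => K ^ (p - q) * C) atTop (𝓝 0) := by
    simpa using (tendsto_rpow_neg_atTop (sub_pos.2 hpq)).mul_const (C : ℝ)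
  obtain ⟨K, hKε, hK⟩ :=
    ((hlim.eventually_le_const (Real.rpow_pos_of_pos hε p)).and (eventually_gt_atTop 0)).exists
  refine ⟨K.toNNReal, fun t => ?_⟩
  rw [eLpNorm_eq_lintegral_rpow_enorm_toReal (by simpa using hp0) ENNReal.ofReal_ne_top,
    ENNReal.toReal_ofReal hp0.le, one_div, ENNReal.rpow_inv_le_iff hp0,
    ENNReal.ofReal_rpow_of_pos hε]
  calc ∫⁻ ω, ‖{ω | K.toNNReal ≤ ‖f t ω‖₊}.indicator (f t) ω‖ₑ ^ p ∂μ
      ≤ ∫⁻ ω, ENNReal.ofReal (K ^ (p - q)) * ‖f t ω‖ₑ ^ q ∂μ := by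
        refine lintegral_mono fun ω => ?_
        by_cases hω : K.toNNReal ≤ ‖f t ω‖₊
        · rw [Set.indicator_of_mem (by exact hω)]
          exact enorm_rpow_le_mul_enorm_rpow hK hpq.le (Real.toNNReal_le_iff_le_coe.1 hω)
        · rw [Set.indicator_of_notMem (by exact hω), enorm_zero, ENNReal.zero_rpow_of_pos hp0]
          exact zero_le
    _ = ENNReal.ofReal (K ^ (p - q)) * ∫⁻ ω, ‖f t ω‖ₑ ^ q ∂μ :=
        lintegral_const_mul' _ _ ENNReal.ofReal_ne_top
    _ ≤ ENNReal.ofReal (K ^ (p - q)) * C := by gcongr; exact hC t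
    _ ≤ ENNReal.ofReal (ε ^ p) := by
        rw [← ENNReal.ofReal_coe_nnreal, ← ENNReal.ofReal_mul (by positivity)]
        exact ENNReal.ofReal_le_ofReal hKε

variable [IsProbabilityMeasure μ] {ι : Type*} {V : ℤ → Ω → ι → ℝ}

lemma const_mem_nearEpochDependent (c : ℝ) :
    (fun _ => Lp.const 2 μ c) ∈ nearEpochDependent μ V :=
  le_uniformClosure _ ⟨0, |c|, fun _ _ => c, abs_nonneg c, fun _ =>
    ⟨measurable_const, fun _ => le_rfl, Lp.coeFn_const 2 μ c⟩⟩

lemma mem_nearEpochDependent_of_uniformIntegrable [Fintype ι] (hV : ∀ t, Measurable (V t))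
    (hUI : UniformIntegrable V 2 μ) (j : ℕ) (a : ι) {e : ℤ → Lp ℝ 2 μ}
    (he : ∀ t, e t =ᵐ[μ] fun ω => V (t - j) ω a) : e ∈ nearEpochDependent μ V := by
  intro ε hε
  obtain ⟨C, hC⟩ := hUI.spec two_ne_zero ENNReal.ofNat_ne_top hε
  let A : Set (ι → ℝ) := {y | ‖y‖₊ < C}
  have hA : MeasurableSet A := measurableSet_lt measurable_nnnorm measurable_const
  let v : ℤ → Ω → ℝ := fun t ω => A.indicator (fun y => y a) (V (t - j) ω)
  have hv_mem : ∀ t ω, V (t - j) ω ∈ A → v t ω = V (t - j) ω a :=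
    fun t ω h => Set.indicator_of_mem h _
  have hv_notMem : ∀ t ω, V (t - j) ω ∉ A → v t ω = 0 := fun t ω h => Set.indicator_of_notMem h _
  have hmeas : ∀ t, Measurable[sigmaOf V (Set.Icc (t - j) t)] (v t) := fun t =>
    ((measurable_pi_apply a).indicator hA).comp (measurable_sigmaOf V (by simp))
  have hbound : ∀ t ω, |v t ω| ≤ C := fun t ω => by
    by_cases hω : V (t - j) ω ∈ A
    · rw [hv_mem t ω hω]
      exact (norm_le_pi_norm _ a).trans (NNReal.coe_le_coe.2 hω.le)
    · rw [hv_notMem t ω hω, abs_zero]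
      exact C.2
  have hL2 : ∀ t, MemLp (v t) 2 μ := fun t =>
    MemLp.of_bound ((hmeas t).mono (sigmaOf_le hV _) le_rfl).aestronglyMeasurable C
      (ae_of_all _ (hbound t))
  refine ⟨fun t => (hL2 t).toLp (v t), ⟨j, C, v, C.2, fun t =>
    ⟨hmeas t, hbound t, (hL2 t).coeFn_toLp⟩⟩, fun t => ?_⟩
  rw [Lp.norm_def]
  refine ENNReal.toReal_le_of_le_ofReal hε.le (le_trans (eLpNorm_mono_ae ?_) (hC (t - j)))
  filter_upwards [Lp.coeFn_sub (e t) ((hL2 t).toLp (v t)), he t, (hL2 t).coeFn_toLp]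
    with ω hsub heω hvω
  rw [hsub, Pi.sub_apply, heω, hvω]
  by_cases hω : V (t - j) ω ∈ A
  · rw [hv_mem t ω hω, sub_self, norm_zero]
    exact norm_nonneg _
  · rw [hv_notMem t ω hω, sub_zero, Set.indicator_of_mem (by simpa [A] using hω)]
    exact norm_le_pi_norm _ a

end Truncation

/-! ### Stationary sequences in a Hilbert space -/

section Hilbert

variable {H : Type*} [NormedAddCommGroup H] [InnerProductSpace ℝ H]

lemma tendsto_starProjection_zero [CompleteSpace H] (U : ℕ → Submodule ℝ H) (hU : Antitone U)
    [∀ n, (U n).HasOrthogonalProjection] (hbot : ⨅ n, U n = ⊥) (x : H) :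
    Tendsto (fun n => (U n).starProjection x) atTop (𝓝 0) := by
  have hmono : Monotone fun n => (U n)ᗮ := fun m n h => Submodule.orthogonal_le (hU h)
  have htop : ⊤ ≤ (⨆ n, (U n)ᗮ).topologicalClosure := by
    rw [← Submodule.orthogonal_orthogonal_eq_closure, ← Submodule.iInf_orthogonal]
    simp only [Submodule.orthogonal_orthogonal, hbot, Submodule.bot_orthogonal_eq_top, le_refl]
  have hlim := Submodule.starProjection_tendsto_self (fun n => (U n)ᗮ) hmono x htop
  simpa only [Submodule.starProjection_orthogonal_val, sub_sub_cancel, sub_self] using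
    hlim.const_sub x

lemma inner_apply_eq_of_mem_span {T : Type*} {S : Set (T → H)}
    (hS : ∀ f ∈ S, ∀ g ∈ S, ∀ s t, inner ℝ (f s) (g s) = inner ℝ (f t) (g t)) {f g : T → H}
    (hf : f ∈ Submodule.span ℝ S) (hg : g ∈ Submodule.span ℝ S) (s t : T) :
    inner ℝ (f s) (g s) = inner ℝ (f t) (g t) := by
  induction hf, hg using Submodule.span_induction₂ with
  | mem_mem f g hf hg => exact hS f hf g hg s t
  | zero_left => simp only [Pi.zero_apply, inner_zero_left]
  | zero_right => simp only [Pi.zero_apply, inner_zero_right]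
  | add_left _ _ _ _ _ _ h h' => simp only [Pi.add_apply, inner_add_left, h, h']
  | add_right _ _ _ _ _ _ h h' => simp only [Pi.add_apply, inner_add_right, h, h']
  | smul_left _ _ _ _ _ h => simp only [Pi.smul_apply, real_inner_smul_left, h]
  | smul_right _ _ _ _ _ h => simp only [Pi.smul_apply, real_inner_smul_right, h]

variable {ι : Type*} {z e : ℤ → ι → H}

/-- The closed linear span of the components of `z s`, `s ∈ S`. -/
def timeSpan (z : ℤ → ι → H) (S : Set ℤ) : Submodule ℝ H :=
  (Submodule.span ℝ {f | ∃ s ∈ S, ∃ a : ι, f = z s a}).topologicalClosure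

lemma mem_timeSpan (z : ℤ → ι → H) {S : Set ℤ} {s : ℤ} (hs : s ∈ S) (a : ι) :
    z s a ∈ timeSpan z S :=
  Submodule.le_topologicalClosure _ (Submodule.subset_span ⟨s, hs, a, rfl⟩)

lemma timeSpan_mono (z : ℤ → ι → H) : Monotone (timeSpan z) := fun _ _ h =>
  Submodule.topologicalClosure_mono (Submodule.span_mono fun _ ⟨s, hs, a, hf⟩ => ⟨s, h hs, a, hf⟩)

instance [CompleteSpace H] (S : Set ℤ) : CompleteSpace (timeSpan z S) :=
  (Submodule.isClosed_topologicalClosure _).completeSpace_coe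

/-- The process `z_{t-j,a}`, that is, the component `a` of `z` lagged `j` times. -/
def lagged (z : ℤ → ι → H) (j : ℕ) (a : ι) : ℤ → H := fun t => z (t - j) a

/-- Finite linear combinations, with coefficients constant in time, of the lags `j ∈ J` of `z`. -/
def lagSpan (z : ℤ → ι → H) (J : Set ℕ) : Submodule ℝ (ℤ → H) :=
  Submodule.span ℝ {f | ∃ j ∈ J, ∃ a, f = lagged z j a}

lemma lagged_mem_lagSpan (z : ℤ → ι → H) {J : Set ℕ} {j : ℕ} (hj : j ∈ J) (a : ι) :
    lagged z j a ∈ lagSpan z J :=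
  Submodule.subset_span ⟨j, hj, a, rfl⟩

lemma lagSpan_mono (z : ℤ → ι → H) : Monotone (lagSpan z) := fun _ _ h =>
  Submodule.span_mono fun _ ⟨j, hj, a, hf⟩ => ⟨j, h hj, a, hf⟩

lemma apply_mem_timeSpan_of_mem_lagSpan {n : ℕ} {f : ℤ → H} (hf : f ∈ lagSpan z (Set.Ici n))
    (t : ℤ) : f t ∈ timeSpan z (Set.Iic (t - n)) := by
  suffices lagSpan z (Set.Ici n) ≤ (timeSpan z (Set.Iic (t - n))).comap (LinearMap.proj t) from
    this hf
  refine Submodule.span_le.2 ?_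
  rintro f ⟨j, hj, a, rfl⟩
  exact mem_timeSpan z (Set.mem_Iic.2 (sub_le_sub_left (Nat.cast_le.2 hj) t)) a

/-- The second moments of `z` are invariant under time shifts. -/
def IsStationary (z : ℤ → ι → H) : Prop :=
  ∀ s t h a b, inner ℝ (z s a) (z (s - h) b) = inner ℝ (z t a) (z (t - h) b)

lemma IsStationary.inner_lagged (hz : IsStationary z) (i j : ℕ) (a b : ι) (s t : ℤ) :
    inner ℝ (lagged z i a s) (lagged z j b s) = inner ℝ (lagged z i a t) (lagged z j b t) := by
  simpa [lagged] using hz (s - i) (t - i) (j - i) a b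

lemma IsStationary.inner_eq_of_mem_lagSpan (hz : IsStationary z) {J : Set ℕ} {f g : ℤ → H}
    (hf : f ∈ lagSpan z J) (hg : g ∈ lagSpan z J) (s t : ℤ) :
    inner ℝ (f s) (g s) = inner ℝ (f t) (g t) := by
  refine inner_apply_eq_of_mem_span ?_ hf hg s t
  rintro _ ⟨i, -, a, rfl⟩ _ ⟨j, -, b, rfl⟩
  exact hz.inner_lagged i j a b

/-- `e` is the innovation of `z`: what remains of `z` after projection onto its strict past. -/
def IsInnovation (z e : ℤ → ι → H) : Prop :=
  ∀ t a, z t a - e t a ∈ timeSpan z (Set.Iic (t - 1)) ∧ e t a ∈ (timeSpan z (Set.Iic (t - 1)))ᗮ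

lemma IsInnovation.inner_eq_zero_of_mem_lagSpan (he : IsInnovation z e) {n : ℕ} {f : ℤ → H}
    (hf : f ∈ lagSpan e (Set.Iio n)) {t : ℤ} {g : H} (hg : g ∈ timeSpan z (Set.Iic (t - n))) :
    inner ℝ g (f t) = 0 := by
  suffices lagSpan e (Set.Iio n) ≤
      ((timeSpan z (Set.Iic (t - n)))ᗮ).comap (LinearMap.proj t) from this hf g hg
  refine Submodule.span_le.2 ?_
  rintro f ⟨j, hj, a, rfl⟩
  have hj : (j : ℤ) < n := by exact_mod_cast hj
  exact Submodule.orthogonal_le (timeSpan_mono z (Set.Iic_subset_Iic.2 (by omega)))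
    (he (t - j) a).2

lemma IsInnovation.inner_eq_zero_of_lt (he : IsInnovation z e) {s t : ℤ} (hst : s < t) (a b : ι) :
    inner ℝ (e t a) (z s b) = 0 :=
  Submodule.inner_left_of_mem_orthogonal
    (mem_timeSpan z (Set.mem_Iic.2 (Int.le_sub_one_of_lt hst)) b) (he t a).2

lemma IsInnovation.inner_eq_inner (he : IsInnovation z e) (t : ℤ) (a b : ι) :
    inner ℝ (e t a) (z t b) = inner ℝ (e t a) (e t b) := by
  rw [← sub_eq_zero, ← inner_sub_right]
  exact Submodule.inner_left_of_mem_orthogonal (he t b).1 (he t a).2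

lemma IsInnovation.inner_eq_zero_of_forall_inner_eq_zero (he : IsInnovation z e) {o : H}
    (ho : ∀ t a, inner ℝ (z t a) o = 0) (t : ℤ) (a : ι) : inner ℝ (e t a) o = 0 := by
  have hspan : timeSpan z (Set.Iic (t - 1)) ≤ (ℝ ∙ o)ᗮ := by
    refine Submodule.topologicalClosure_minimal _ (Submodule.span_le.2 ?_)
      (Submodule.isClosed_orthogonal _)
    rintro _ ⟨s, -, b, rfl⟩
    exact Submodule.mem_orthogonal_singleton_iff_inner_left.2 (ho s b)
  have hpred := Submodule.mem_orthogonal_singleton_iff_inner_left.1 (hspan (he t a).1)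
  rwa [inner_sub_left, ho, zero_sub, neg_eq_zero] at hpred

lemma IsInnovation.starProjection_orthogonal_eq [CompleteSpace H] (he : IsInnovation z e) (t : ℤ)
    (a : ι) : (timeSpan z (Set.Iic (t - 1)))ᗮ.starProjection (z t a) = e t a := by
  rw [← sub_add_cancel (z t a) (e t a), map_add,
    Submodule.starProjection_orthogonal_apply_eq_zero (he t a).1,
    Submodule.starProjection_eq_self_iff.2 (he t a).2, zero_add]

/-- Projecting a vanishing combination onto the orthogonal complement of the past before its latest
time `m` leaves a combination of the components of `e m`. -/
theorem IsInnovation.linearIndependent [CompleteSpace H] (he : IsInnovation z e)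
    (hind : ∀ t, LinearIndependent ℝ (e t)) :
    LinearIndependent ℝ fun q : ℤ × ι => z q.1 q.2 := by
  classical
  rw [linearIndependent_iff']
  intro s g hsum
  by_contra! hne
  obtain ⟨⟨m, a⟩, hma, hmax⟩ := (s.filter (g · ≠ 0)).exists_max_image Prod.fst
    (hne.imp fun i hi => Finset.mem_filter.2 hi)
  let P := (timeSpan z (Set.Iic (m - 1)))ᗮ.starProjection
  have hP_now : ∀ b, P (z m b) = e m b := he.starProjection_orthogonal_eq m
  have hP_past : ∀ r < m, ∀ b, P (z r b) = 0 := fun r hr b =>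
    Submodule.starProjection_orthogonal_apply_eq_zero
      (mem_timeSpan z (Set.mem_Iic.2 (Int.le_sub_one_of_lt hr)) b)
  have hP : ∀ i ∈ s, g i • P (z i.1 i.2) = if i.1 = m then g i • e m i.2 else 0 := by
    intro i hi
    by_cases hgi : g i = 0
    · simp only [hgi, zero_smul, ite_self]
    have hle : i.1 ≤ m := hmax i (Finset.mem_filter.2 ⟨hi, hgi⟩)
    split_ifs with him
    · rw [him, hP_now]
    · rw [hP_past _ (hle.lt_of_ne him), smul_zero]
  have hfilter : ∑ i ∈ s.filter (·.1 = m), g i • e m i.2 = 0 := by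
    rw [Finset.sum_filter, ← Finset.sum_congr rfl hP]
    simpa only [map_sum, map_smul, map_zero] using congrArg P hsum
  have hindOn : LinearIndepOn ℝ (fun i : ℤ × ι => e m i.2) {i | i.1 = m} :=
    (hind m).comp (fun i : {i : ℤ × ι | i.1 = m} => i.1.2) fun i j hij =>
      Subtype.ext (Prod.ext (i.2.trans j.2.symm) hij)
  rw [Finset.mem_filter] at hma
  exact hma.2 (linearIndepOn_iff'.1 hindOn _ g (fun i hi => (Finset.mem_filter.1 hi).2) hfilter _
    (Finset.mem_filter.2 ⟨hma.1, rfl⟩))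

variable {p : ℕ}

/-- The span of the components of `z (t - 1), …, z (t - p)`. -/
def predictorSpan (z : ℤ → ι → H) (p : ℕ) (t : ℤ) : Submodule ℝ H :=
  Submodule.span ℝ (Set.range fun q : Fin p × ι => z (t - (q.1 + 1)) q.2)

lemma predictorSpan_le (z : ℤ → ι → H) (p : ℕ) (t : ℤ) :
    predictorSpan z p t ≤ timeSpan z (Set.Iic (t - 1)) := by
  refine Submodule.span_le.2 ?_
  rintro _ ⟨q, rfl⟩
  exact mem_timeSpan z (Set.mem_Iic.2 (by omega)) q.2

lemma IsStationary.apply_mem_orthogonal_predictorSpan (hz : IsStationary z) {f : ℤ → H}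
    (hf : f ∈ lagSpan z Set.univ) (hf0 : f 0 ∈ (predictorSpan z p 0)ᗮ) (t : ℤ) :
    f t ∈ (predictorSpan z p t)ᗮ := by
  suffices predictorSpan z p t ≤ (ℝ ∙ f t)ᗮ from
    fun w hw => Submodule.mem_orthogonal_singleton_iff_inner_left.1 (this hw)
  refine Submodule.span_le.2 ?_
  rintro _ ⟨q, rfl⟩
  refine Submodule.mem_orthogonal_singleton_iff_inner_left.2 ?_
  have hshift := hz.inner_eq_of_mem_lagSpan
    (lagged_mem_lagSpan z (Set.mem_univ (q.1 + 1 : ℕ)) q.2) hf t 0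
  simpa [lagged] using hshift.trans (hf0 _ (Submodule.subset_span ⟨q, by simp [lagged]⟩))

variable [Fintype ι] {Ψ Ψ' : Fin p → Matrix ι ι ℝ}

/-- `z` solves the vector autoregression `z_t = ∑_{j=1}^p Ψ_j z_{t-j} + e_t`; as in `IsVAR`, `Ψ j`
is the coefficient of lag `j + 1`. -/
def IsAutoregression (Ψ : Fin p → Matrix ι ι ℝ) (z e : ℤ → ι → H) : Prop :=
  ∀ t a, z t a = ∑ j, ∑ b, Ψ j a b • z (t - (j + 1)) b + e t a

/-- The residual of the regression of `z 0` on its lags, shifted in time, stays orthogonal to the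
lags by stationarity. So does the innovation, and the two differ by a combination of lags. -/
theorem IsStationary.exists_isAutoregression (hz : IsStationary z) (he : IsInnovation z e)
    (hp : ∀ t a, z t a - e t a ∈ predictorSpan z p t) :
    ∃ Ψ : Fin p → Matrix ι ι ℝ, IsAutoregression Ψ z e := by
  have hcoeff : ∀ a, ∃ c : Fin p × ι → ℝ, ∑ q, c q • z (0 - (q.1 + 1)) q.2 = z 0 a - e 0 a :=
    fun a => (Submodule.mem_span_range_iff_exists_fun ℝ).1 (hp 0 a)
  choose c hc using hcoeff
  let pred : ι → ℤ → H := fun a => ∑ q : Fin p × ι, c a q • lagged z (q.1 + 1) q.2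
  have hpred : ∀ a t, pred a t = ∑ q : Fin p × ι, c a q • z (t - (q.1 + 1)) q.2 := fun a t => by
    simp [pred, lagged]
  have hres : ∀ a, lagged z 0 a - pred a ∈ lagSpan z Set.univ := fun a =>
    sub_mem (lagged_mem_lagSpan z (Set.mem_univ _) a) (sum_mem fun q _ =>
      Submodule.smul_mem _ _ (lagged_mem_lagSpan z (Set.mem_univ _) q.2))
  have hres_zero : ∀ a, (lagged z 0 a - pred a) 0 = e 0 a := fun a => by
    rw [Pi.sub_apply, hpred, hc]
    simp [lagged]
  have he_orth : ∀ t a, e t a ∈ (predictorSpan z p t)ᗮ := fun t a =>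
    Submodule.orthogonal_le (predictorSpan_le z p t) (he t a).2
  refine ⟨fun j => Matrix.of fun a b => c a (j, b), fun t a => ?_⟩
  have hmem : (lagged z 0 a - pred a) t - e t a ∈
      predictorSpan z p t ⊓ (predictorSpan z p t)ᗮ := by
    refine ⟨?_, sub_mem (hz.apply_mem_orthogonal_predictorSpan (hres a) ?_ t) (he_orth t a)⟩
    swap
    · exact hres_zero a ▸ he_orth 0 a
    have hpredt : pred a t ∈ predictorSpan z p t := hpred a t ▸ sum_mem fun q _ =>
      Submodule.smul_mem _ _ (Submodule.subset_span ⟨q, rfl⟩)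
    simpa [lagged, sub_right_comm] using sub_mem (hp t a) hpredt
  rw [Submodule.inf_orthogonal_eq_bot, Submodule.mem_bot, Pi.sub_apply, sub_sub, sub_eq_zero, hpred,
    Fintype.sum_prod_type] at hmem
  simpa [lagged] using hmem

lemma IsAutoregression.eq (hΨ : IsAutoregression Ψ z e)
    (hΨ' : IsAutoregression Ψ' z e) (hz : LinearIndependent ℝ fun q : ℤ × ι => z q.1 q.2) :
    Ψ = Ψ' := by
  have hinj : Function.Injective fun q : Fin p × ι => ((0 : ℤ) - (q.1 + 1), q.2) := by
    rintro ⟨i, a⟩ ⟨j, b⟩ h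
    obtain ⟨hij, hab⟩ := Prod.mk.inj h
    exact Prod.ext (Fin.ext (by dsimp only at hij ⊢; omega)) hab
  ext j a b
  have hsum : ∑ q : Fin p × ι, (Ψ q.1 a q.2 - Ψ' q.1 a q.2) • z (0 - (q.1 + 1)) q.2 = 0 := by
    simp only [sub_smul, Finset.sum_sub_distrib, Fintype.sum_prod_type]
    exact sub_eq_zero.2 (add_right_cancel ((hΨ 0 a).symm.trans (hΨ' 0 a)))
  exact sub_eq_zero.1 (Fintype.linearIndependent_iff.1 (hz.comp _ hinj) _ hsum (j, b))

lemma IsAutoregression.lagged_eq (h : IsAutoregression Ψ z e) (n : ℕ) (a : ι) :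
    lagged z n a = lagged e n a + ∑ j, ∑ b, Ψ j a b • lagged z (n + (j + 1)) b := by
  ext t
  simp only [Pi.add_apply, Finset.sum_apply, Pi.smul_apply, lagged, Nat.cast_add, Nat.cast_one,
    ← sub_sub]
  rw [h, add_comm]
  simp only [← sub_sub]

lemma IsAutoregression.lagSpan_univ_le (h : IsAutoregression Ψ z e) (n : ℕ) :
    lagSpan z Set.univ ≤ lagSpan e (Set.Iio n) ⊔ lagSpan z (Set.Ici n) := by
  induction n with
  | zero => exact le_sup_of_le_right (lagSpan_mono z fun j _ => Nat.zero_le j)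
  | succ n ih =>
    refine ih.trans (sup_le (le_sup_of_le_left (lagSpan_mono e (Set.Iio_subset_Iio n.le_succ)))
      (Submodule.span_le.2 ?_))
    rintro f ⟨j, hj, a, rfl⟩
    rcases (Set.mem_Ici.1 hj).eq_or_lt with rfl | hlt
    · rw [h.lagged_eq]
      exact Submodule.add_mem_sup (lagged_mem_lagSpan e (Set.mem_Iio.2 n.lt_succ_self) a)
        (sum_mem fun j _ => sum_mem fun b _ =>
          Submodule.smul_mem _ _ (lagged_mem_lagSpan z (Set.mem_Ici.2 (by omega)) b))
    · exact Submodule.mem_sup_right (lagged_mem_lagSpan z hlt a)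

/-- Iterating the autoregression `n` times writes a combination of lags as a finite moving average
plus a remainder, which is its projection onto the past before `n`; that projection tends to `0`,
and by stationarity the norm of the remainder does not depend on time. -/
theorem IsAutoregression.lagSpan_le_uniformClosure [CompleteSpace H] (h : IsAutoregression Ψ z e)
    (hz : IsStationary z) (he : IsInnovation z e) (hpnd : ⨅ n : ℤ, timeSpan z (Set.Iic n) = ⊥) :
    lagSpan z Set.univ ≤ uniformClosure (lagSpan e Set.univ) := by
  intro f hf ε hε
  let U : ℕ → Submodule ℝ H := fun n => timeSpan z (Set.Iic (0 - n))
  have hU : Antitone U := fun m n hmn =>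
    timeSpan_mono z (Set.Iic_subset_Iic.2 (by omega))
  have hbot : ⨅ n, U n = ⊥ := by
    rw [eq_bot_iff, ← hpnd]
    exact le_iInf fun n => (iInf_le U n.natAbs).trans
      (timeSpan_mono z (Set.Iic_subset_Iic.2 (by omega)))
  have hlim := tendsto_starProjection_zero U hU hbot (f 0)
  obtain ⟨n, hn⟩ := (hlim.norm.eventually_le_const (by simpa using hε)).exists
  obtain ⟨g, hg, r, hr, rfl⟩ := Submodule.mem_sup.1 (h.lagSpan_univ_le n hf)
  have hproj : (U n).starProjection ((g + r) 0) = r 0 :=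
    Submodule.eq_starProjection_of_mem_of_inner_eq_zero (apply_mem_timeSpan_of_mem_lagSpan hr 0)
      fun w hw => by
        rw [Pi.add_apply, add_sub_cancel_right, real_inner_comm]
        exact he.inner_eq_zero_of_mem_lagSpan hg hw
  refine ⟨g, lagSpan_mono e (Set.subset_univ _) hg, fun t => ?_⟩
  have hnorm : ‖r t‖ = ‖r 0‖ := by
    rw [norm_eq_sqrt_real_inner, norm_eq_sqrt_real_inner, hz.inner_eq_of_mem_lagSpan hr hr t 0]
  rwa [Pi.add_apply, add_sub_cancel_left, hnorm, ← hproj]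

end Hilbert

section AffineLags

variable {H : Type*} [NormedAddCommGroup H] [InnerProductSpace ℝ H] {ι : Type*}
  {z : ℤ → ι → H} {o : H}

/-- Linear combinations, with coefficients constant in time, of the lags of `z` and of the process
that is constantly `o`; for `z` in `L²` and `o = 1` these are the affine functions of the lags. -/
def affineLagSpan (z : ℤ → ι → H) (o : H) : Submodule ℝ (ℤ → H) :=
  Submodule.span ℝ (insert (fun _ => o) {f | ∃ j a, f = lagged z j a})

lemma const_mem_affineLagSpan (z : ℤ → ι → H) (o : H) : (fun _ => o) ∈ affineLagSpan z o :=
  Submodule.subset_span (Set.mem_insert _ _)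

lemma lagged_mem_affineLagSpan (z : ℤ → ι → H) (o : H) (j : ℕ) (a : ι) :
    lagged z j a ∈ affineLagSpan z o :=
  Submodule.subset_span (Set.mem_insert_of_mem _ ⟨j, a, rfl⟩)

lemma affineLagSpan_le {S : Submodule ℝ (ℤ → H)} (ho : (fun _ => o) ∈ S)
    (hz : ∀ j a, lagged z j a ∈ S) : affineLagSpan z o ≤ S := by
  refine Submodule.span_le.2 (Set.insert_subset ho ?_)
  rintro _ ⟨j, a, rfl⟩
  exact hz j a

lemma IsStationary.inner_eq_of_mem_affineLagSpan (hz : IsStationary z)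
    (ho : ∀ t a, inner ℝ (z t a) o = 0) {f g : ℤ → H} (hf : f ∈ affineLagSpan z o)
    (hg : g ∈ affineLagSpan z o) (s t : ℤ) : inner ℝ (f s) (g s) = inner ℝ (f t) (g t) := by
  refine inner_apply_eq_of_mem_span ?_ hf hg s t
  rintro _ (rfl | ⟨i, a, rfl⟩) _ (rfl | ⟨j, b, rfl⟩) s t
  · rfl
  · simp only [lagged, real_inner_comm (z _ _) o, ho]
  · simp only [lagged, ho]
  · exact hz.inner_lagged i j a b s t

end AffineLags

/-! ### Realisation in `L²` -/

section L2

variable {Ω : Type*} [mΩ : MeasurableSpace Ω] {μ : Measure Ω} {ι : Type*} {Z : ℤ → Ω → ι → ℝ}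

lemma coeFn_sum_smul {κ : Type*} [Fintype κ] (c : κ → ℝ) {f : κ → Lp ℝ 2 μ} {F : κ → Ω → ℝ}
    (hf : ∀ i, f i =ᵐ[μ] F i) :
    (∑ i, c i • f i : Lp ℝ 2 μ) =ᵐ[μ] fun ω => ∑ i, c i * F i ω := by
  have hterm : ∀ᵐ ω ∂μ, ∀ i, (c i • f i : Lp ℝ 2 μ) ω = c i * F i ω := by
    refine ae_all_iff.2 fun i => ?_
    filter_upwards [Lp.coeFn_smul (c i) (f i), hf i] with ω hsmul hω
    rw [hsmul, Pi.smul_apply, hω, smul_eq_mul]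
  filter_upwards [Lp.coeFn_fun_finsetSum Finset.univ fun i => c i • f i, hterm] with ω hsum hω
  rw [hsum]
  exact Finset.sum_congr rfl fun i _ => hω i

/-- The components of `Z`, as elements of `L²`. -/
def procL2 (μ : Measure Ω) (Z : ℤ → Ω → ι → ℝ) (t : ℤ) (a : ι) : Lp ℝ 2 μ :=
  toL2 μ fun ω => Z t ω a

/-- The innovations of `Z`, as elements of `L²`. -/
def innovL2 (μ : Measure Ω) (Z : ℤ → Ω → ι → ℝ) (t : ℤ) (a : ι) : Lp ℝ 2 μ :=
  procL2 μ Z t a - linPred μ Z (Set.Iic (t - 1)) t a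

lemma linSpace_eq_timeSpan (S : Set ℤ) : linSpace μ Z S = timeSpan (procL2 μ Z) S := rfl

lemma coeFn_innovL2 (t : ℤ) (a : ι) : innovL2 μ Z t a =ᵐ[μ] fun ω => innov μ Z t ω a :=
  ae_of_all _ fun _ => rfl

lemma measurable_innov (t : ℤ) : Measurable (innov μ Z t) :=
  measurable_pi_lambda _ fun a => (Lp.stronglyMeasurable (innovL2 μ Z t a)).measurable

lemma innovCov_eq_gram (t : ℤ) : innovCov μ Z t = Matrix.gram ℝ (innovL2 μ Z t) := by
  ext a b
  exact (inner_eq_integral_of_ae (coeFn_innovL2 t a) (coeFn_innovL2 t b)).symm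

lemma isInnovation_innovL2 : IsInnovation (procL2 μ Z) (innovL2 μ Z) := by
  intro t a
  have : CompleteSpace (linSpace μ Z (Set.Iic (t - 1))) :=
    (Submodule.isClosed_topologicalClosure _).completeSpace_coe
  rw [← linSpace_eq_timeSpan, innovL2, sub_sub_cancel]
  exact ⟨Submodule.starProjection_apply_mem _ _, Submodule.sub_starProjection_mem_orthogonal _⟩

lemma FinitePredictor.sub_innovL2_mem_predictorSpan [Finite ι] {p : ℕ}
    (hF : FinitePredictor μ Z p) (t : ℤ) (a : ι) :
    procL2 μ Z t a - innovL2 μ Z t a ∈ predictorSpan (procL2 μ Z) p t := by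
  have hset : {f | ∃ s ∈ Set.Icc (t - p) (t - 1), ∃ b : ι, f = toL2 μ fun ω => Z s ω b} ⊆
      Set.range fun q : Fin p × ι => procL2 μ Z (t - (q.1 + 1)) q.2 := by
    rintro f ⟨s, ⟨hps, hst⟩, b, rfl⟩
    obtain ⟨j, hj⟩ := Int.eq_ofNat_of_zero_le (sub_nonneg.2 hst)
    refine ⟨(⟨j, by omega⟩, b), ?_⟩
    have hs : t - (j + 1) = s := by omega
    simp only [hs, procL2]
  have : FiniteDimensional ℝ (predictorSpan (procL2 μ Z) p t) :=
    FiniteDimensional.span_of_finite ℝ (Set.finite_range _)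
  have hle : linSpace μ Z (Set.Icc (t - p) (t - 1)) ≤ predictorSpan (procL2 μ Z) p t :=
    Submodule.topologicalClosure_minimal _ (Submodule.span_mono hset)
      (Submodule.closed_of_finiteDimensional _)
  rw [innovL2, sub_sub_cancel, hF t a]
  exact hle (Submodule.coe_mem _)

lemma CovStationary.coeFn_procL2 (hS : CovStationary μ Z) (t : ℤ) (a : ι) :
    procL2 μ Z t a =ᵐ[μ] fun ω => Z t ω a := by
  rw [procL2, toL2, dif_pos (hS.memLp t a)]
  exact MemLp.coeFn_toLp _

lemma CovStationary.isStationary (hS : CovStationary μ Z) (hm : ∀ t a, ∫ ω, Z t ω a ∂μ = 0) :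
    IsStationary (procL2 μ Z) := by
  have hcov : ∀ s r a b, inner ℝ (procL2 μ Z s a) (procL2 μ Z r b) =
      ProbabilityTheory.covariance (fun ω => Z s ω a) (fun ω => Z r ω b) μ := by
    intro s r a b
    rw [inner_eq_integral_of_ae (hS.coeFn_procL2 s a) (hS.coeFn_procL2 r b),
      ProbabilityTheory.covariance]
    simp only [hm, sub_zero]
  intro s t h a b
  rw [hcov, hcov, hS.cov s t h a b]

lemma CovStationary.inner_procL2_one [IsFiniteMeasure μ] (hS : CovStationary μ Z)
    (hm : ∀ t a, ∫ ω, Z t ω a ∂μ = 0) (t : ℤ) (a : ι) :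
    inner ℝ (procL2 μ Z t a) (Lp.const 2 μ (1 : ℝ)) = 0 := by
  rw [inner_eq_integral_of_ae (hS.coeFn_procL2 t a) (Lp.coeFn_const 2 μ (1 : ℝ))]
  simpa only [Function.const_apply, mul_one] using hm t a

lemma linearIndependent_procL2 [Finite ι] (hpd : ∀ t, (innovCov μ Z t).PosDef) :
    LinearIndependent ℝ fun q : ℤ × ι => procL2 μ Z q.1 q.2 :=
  isInnovation_innovL2.linearIndependent fun t =>
    Matrix.linearIndependent_of_posDef_gram (by simpa only [innovCov_eq_gram] using hpd t)

section VectorAutoregression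

variable [Fintype ι] {p : ℕ} {Ψ : Fin p → Matrix ι ι ℝ}

lemma CovStationary.isVAR_iff (hS : CovStationary μ Z) :
    IsVAR μ Z p Ψ ↔ IsAutoregression Ψ (procL2 μ Z) (innovL2 μ Z) := by
  have hrhs : ∀ t a, (∑ j, ∑ b, Ψ j a b • procL2 μ Z (t - (j + 1)) b + innovL2 μ Z t a : Lp ℝ 2 μ)
      =ᵐ[μ] fun ω => (∑ j, (Ψ j).mulVec (Z (t - (j + 1)) ω) + innov μ Z t ω) a := by
    intro t a
    have hsum := coeFn_sum_smul (fun q : Fin p × ι => Ψ q.1 a q.2)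
      fun q => hS.coeFn_procL2 (t - (q.1 + 1)) q.2
    simp only [Fintype.sum_prod_type] at hsum
    filter_upwards [Lp.coeFn_add (∑ j, ∑ b, Ψ j a b • procL2 μ Z (t - (j + 1)) b) (innovL2 μ Z t a),
      hsum] with ω hadd hω
    rw [hadd, Pi.add_apply, hω, Pi.add_apply, Finset.sum_apply]
    rfl
  have hiff : ∀ t a, procL2 μ Z t a = ∑ j, ∑ b, Ψ j a b • procL2 μ Z (t - (j + 1)) b +
      innovL2 μ Z t a ↔
      ∀ᵐ ω ∂μ, Z t ω a = (∑ j, (Ψ j).mulVec (Z (t - (j + 1)) ω) + innov μ Z t ω) a := fun t a =>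
    ⟨fun h => (hS.coeFn_procL2 t a).symm.trans (h ▸ hrhs t a),
      fun h => Lp.ext (((hS.coeFn_procL2 t a).trans h).trans (hrhs t a).symm)⟩
  simp only [IsVAR, IsAutoregression, hiff, ← ae_all_iff, funext_iff]

theorem existsUnique_isVAR (hS : CovStationary μ Z) (hm : ∀ t a, ∫ ω, Z t ω a ∂μ = 0)
    (hF : FinitePredictor μ Z p) (hpd : ∀ t, (innovCov μ Z t).PosDef) :
    ∃! Ψ : Fin p → Matrix ι ι ℝ, IsVAR μ Z p Ψ := by
  obtain ⟨Ψ, hΨ⟩ := (hS.isStationary hm).exists_isAutoregression isInnovation_innovL2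
    hF.sub_innovL2_mem_predictorSpan
  exact ⟨Ψ, hS.isVAR_iff.2 hΨ, fun Ψ' hΨ' =>
    (hS.isVAR_iff.1 hΨ').eq hΨ (linearIndependent_procL2 hpd)⟩

lemma Assumption1.tendsto_alphaMix_innov (h : Assumption1 μ Z p) :
    Tendsto (alphaMix μ (innov μ Z)) atTop (𝓝 0) := by
  obtain ⟨δ, -, hα, -⟩ := h.mixing
  exact hα

variable [IsProbabilityMeasure μ]

lemma IsVAR.affineLagSpan_le_nearEpochDependent (hΨ : IsVAR μ Z p Ψ) (hS : CovStationary μ Z)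
    (hm : ∀ t a, ∫ ω, Z t ω a ∂μ = 0) (hpnd : PurelyNondeterministic μ Z)
    (hUI : UniformIntegrable (innov μ Z) 2 μ) :
    affineLagSpan (procL2 μ Z) (Lp.const 2 μ 1) ≤ nearEpochDependent μ (innov μ Z) := by
  have hinnov : lagSpan (innovL2 μ Z) Set.univ ≤ nearEpochDependent μ (innov μ Z) := by
    refine Submodule.span_le.2 ?_
    rintro _ ⟨j, -, a, rfl⟩
    exact mem_nearEpochDependent_of_uniformIntegrable measurable_innov hUI j a fun t =>
      coeFn_innovL2 (t - j) a
  have hlags := (hS.isVAR_iff.1 hΨ).lagSpan_le_uniformClosure (hS.isStationary hm)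
    isInnovation_innovL2 hpnd
  exact affineLagSpan_le (const_mem_nearEpochDependent 1) fun j a =>
    uniformClosure_le hinnov (hlags (lagged_mem_lagSpan _ (Set.mem_univ j) a))

theorem IsVAR.tendstoInMeasure_cesaroMean_mul (hΨ : IsVAR μ Z p Ψ) (hS : CovStationary μ Z)
    (hm : ∀ t a, ∫ ω, Z t ω a ∂μ = 0) (hpnd : PurelyNondeterministic μ Z)
    (hα : Tendsto (alphaMix μ (innov μ Z)) atTop (𝓝 0)) (hUI : UniformIntegrable (innov μ Z) 2 μ)
    {f g : ℤ → Lp ℝ 2 μ} (hf : f ∈ affineLagSpan (procL2 μ Z) (Lp.const 2 μ 1))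
    (hg : g ∈ affineLagSpan (procL2 μ Z) (Lp.const 2 μ 1)) {F G : ℤ → Ω → ℝ}
    (hfF : ∀ t, f t =ᵐ[μ] F t) (hgG : ∀ t, g t =ᵐ[μ] G t) (c : ℤ) :
    TendstoInMeasure μ (fun n ω => cesaroMean (fun i => F (c + i) ω * G (c + i) ω) n) atTop
      fun _ => inner ℝ (f 0) (g 0) := by
  have hle := hΨ.affineLagSpan_le_nearEpochDependent hS hm hpnd hUI
  exact Durbin.tendstoInMeasure_cesaroMean_mul measurable_innov hα (hle hf) (hle hg) hfF hgG
    (fun t => (hS.isStationary hm).inner_eq_of_mem_affineLagSpan (hS.inner_procL2_one hm) hf hg t 0)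
    c

lemma Assumption1.uniformIntegrable_innov (h : Assumption1 μ Z p) :
    UniformIntegrable (innov μ Z) 2 μ := by
  obtain ⟨δ, hδ, -, -, C, hC⟩ := h.mixing
  have hUI := uniformIntegrable_of_lintegral_rpow_le (p := 2) (q := 4 + 2 * δ)
    (fun t => (measurable_innov t).aestronglyMeasurable) one_le_two (by linarith) hC
  rwa [ENNReal.ofReal_ofNat] at hUI

end VectorAutoregression

end L2

/-! ### Consistency of least squares -/

section LeastSquares

variable {Ω T : Type*} [mΩ : MeasurableSpace Ω] {μ : Measure Ω} {l : Filter T}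

lemma tendsto_measure_notMem_of_tendstoInMeasure {E : Type*} [PseudoMetricSpace E]
    {X : T → Ω → E} {x : E} (hX : TendstoInMeasure μ X l fun _ => x) {U : Set E} (hU : U ∈ 𝓝 x) :
    Tendsto (fun n => μ {ω | X n ω ∉ U}) l (𝓝 0) := by
  obtain ⟨r, hr, hrU⟩ := Metric.mem_nhds_iff.1 hU
  refine tendsto_of_tendsto_of_tendsto_of_le_of_le tendsto_const_nhds
    (tendstoInMeasure_iff_dist.1 hX r hr) (fun _ => zero_le) fun n => measure_mono fun ω hω => ?_
  exact not_lt.1 fun hlt => hω (hrU (Metric.mem_ball.2 hlt))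

lemma tendstoInMeasure_comp_of_continuousAt {E F : Type*} [PseudoMetricSpace E]
    [PseudoMetricSpace F] {X : T → Ω → E} {x : E} (hX : TendstoInMeasure μ X l fun _ => x)
    {φ : E → F} (hφ : ContinuousAt φ x) :
    TendstoInMeasure μ (fun n ω => φ (X n ω)) l fun _ => φ x := by
  rw [tendstoInMeasure_iff_dist]
  intro ε hε
  simpa only [Set.mem_preimage, Metric.mem_ball, not_lt] using
    tendsto_measure_notMem_of_tendstoInMeasure hX (hφ (Metric.ball_mem_nhds (φ x) hε))

lemma tendstoInMeasure_pi {σ : Type*} [Fintype σ] {E : σ → Type*} [∀ s, PseudoMetricSpace (E s)]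
    {X : T → Ω → ∀ s, E s} {Y : Ω → ∀ s, E s}
    (hX : ∀ s, TendstoInMeasure μ (fun n ω => X n ω s) l fun ω => Y ω s) :
    TendstoInMeasure μ X l Y := by
  rw [tendstoInMeasure_iff_dist]
  intro r hr
  have hsum : Tendsto (fun n => ∑ s, μ {ω | r ≤ dist (X n ω s) (Y ω s)}) l (𝓝 0) := by
    simpa only [Finset.sum_const_zero] using
      tendsto_finsetSum Finset.univ fun s _ => tendstoInMeasure_iff_dist.1 (hX s) r hr
  refine tendsto_of_tendsto_of_tendsto_of_le_of_le tendsto_const_nhds hsum (fun _ => zero_le)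
    fun n => (measure_mono fun ω hω => ?_).trans
      (measure_iUnion_fintype_le μ fun s => {ω | r ≤ dist (X n ω s) (Y ω s)})
  by_contra hcon
  simp only [Set.mem_iUnion, Set.mem_ofPred_eq, not_exists, not_le] at hcon
  exact not_lt.2 hω ((dist_pi_lt_iff hr).2 hcon)

lemma tendstoInMeasure_prodMk {E F : Type*} [PseudoMetricSpace E] [PseudoMetricSpace F]
    {X : T → Ω → E} {X' : Ω → E} {Y : T → Ω → F} {Y' : Ω → F} (hX : TendstoInMeasure μ X l X')
    (hY : TendstoInMeasure μ Y l Y') :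
    TendstoInMeasure μ (fun n ω => (X n ω, Y n ω)) l fun ω => (X' ω, Y' ω) := by
  rw [tendstoInMeasure_iff_dist] at hX hY ⊢
  intro r hr
  have hsum : Tendsto (fun n => μ {ω | r ≤ dist (X n ω) (X' ω)} + μ {ω | r ≤ dist (Y n ω) (Y' ω)})
      l (𝓝 0) := by
    simpa only [add_zero] using (hX r hr).add (hY r hr)
  refine tendsto_of_tendsto_of_tendsto_of_le_of_le tendsto_const_nhds hsum (fun _ => zero_le)
    fun n => (measure_mono fun ω hω => ?_).trans (measure_union_le _ _)
  simpa only [Prod.dist_eq, Set.mem_union, Set.mem_ofPred_eq, le_max_iff] using hω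

variable {κ : Type*} [Fintype κ] [DecidableEq κ] {A : T → Ω → Matrix κ κ ℝ} {Q : Matrix κ κ ℝ}

lemma tendsto_measure_not_isUnit_det
    (hA : ∀ a b, TendstoInMeasure μ (fun n ω => A n ω a b) l fun _ => Q a b) (hQ : IsUnit Q.det) :
    Tendsto (fun n => μ {ω | ¬IsUnit (A n ω).det}) l (𝓝 0) := by
  have hApi : TendstoInMeasure μ (E := κ → κ → ℝ) A l fun _ => Q :=
    tendstoInMeasure_pi fun a => tendstoInMeasure_pi (hA a)
  have hopen : IsOpen {M : κ → κ → ℝ | IsUnit (Matrix.of M).det} :=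
    Units.isOpen.preimage (Continuous.matrix_det continuous_id)
  exact tendsto_measure_notMem_of_tendstoInMeasure hApi (hopen.mem_nhds hQ)

lemma continuousAt_inv_mulVec {b : κ → ℝ} (hQ : IsUnit Q.det) :
    ContinuousAt (fun v : (κ → κ → ℝ) × (κ → ℝ) => (Matrix.of v.1)⁻¹.mulVec v.2) (Q, b) := by
  have hof : Continuous fun v : (κ → κ → ℝ) × (κ → ℝ) => Matrix.of v.1 := continuous_fst
  have hadj := hof.matrix_adjugate.matrix_mulVec (continuous_snd (X := κ → κ → ℝ))
  simp only [Matrix.inv_def, Ring.inverse_eq_inv', Matrix.smul_mulVec]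
  exact (hof.matrix_det.continuousAt.inv₀ (a := (Q, b)) hQ.ne_zero).smul hadj.continuousAt

theorem tendstoInMeasure_inv_mulVec {b : T → Ω → κ → ℝ} {θ : κ → ℝ}
    (hA : ∀ a b, TendstoInMeasure μ (fun n ω => A n ω a b) l fun _ => Q a b) (hQ : IsUnit Q.det)
    (hb : ∀ a, TendstoInMeasure μ (fun n ω => b n ω a) l fun _ => Q.mulVec θ a) :
    TendstoInMeasure μ (fun n ω => (A n ω)⁻¹.mulVec (b n ω)) l fun _ => θ := by
  have hAb : TendstoInMeasure μ (E := (κ → κ → ℝ) × (κ → ℝ)) (fun n ω => (A n ω, b n ω)) l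
      fun _ => (Q, Q.mulVec θ) :=
    tendstoInMeasure_prodMk (tendstoInMeasure_pi fun a => tendstoInMeasure_pi (hA a))
      (tendstoInMeasure_pi hb)
  have hθ : Q⁻¹.mulVec (Q.mulVec θ) = θ := by
    rw [Matrix.mulVec_mulVec, Matrix.nonsing_inv_mul Q hQ, Matrix.one_mulVec]
  exact hθ ▸ tendstoInMeasure_comp_of_continuousAt hAb (continuousAt_inv_mulVec hQ)

end LeastSquares

/-! ### The augmented regression -/

section AugmentedRegression

variable {N : ℕ} {k : Fin N → ℕ} {p : ℕ} {H : Type*}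

section Module

variable [AddCommGroup H] [Module ℝ H]

/-- The regressors `x_t`, recovered from the centred process `z` and the constant `o = 1`. -/
def regX (μx : XIdx k → ℝ) (z : ℤ → ZIdx k → H) (o : H) (t : ℤ) (a : XIdx k) : H :=
  z t (Sum.inl a) + μx a • o

/-- The dependent variables `y_t`, recovered from the centred process `z` and the constant
`o = 1`. -/
def regY (α : Fin N → ℝ) (β μx : XIdx k → ℝ) (z : ℤ → ZIdx k → H) (o : H) (t : ℤ) (i : Fin N) : H :=
  α i • o + ∑ a : Fin (k i), β ⟨i, a⟩ • regX μx z o t ⟨i, a⟩ + z t (Sum.inr i)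

/-- The regressor vector `w_{i,t}` of `wVec`, recovered from the centred process `z` and the
constant `o = 1`. -/
def regW (α : Fin N → ℝ) (β μx : XIdx k → ℝ) (z : ℤ → ZIdx k → H) (o : H) (p : ℕ) (i : Fin N)
    (t : ℤ) : WIdx k p i → H :=
  Sum.elim (fun _ => o) <| Sum.elim (fun a => regX μx z o t ⟨i, a⟩) <|
    Sum.elim (fun jl => regY α β μx z o (t - (jl.1 + 1)) jl.2)
      (fun ja => regX μx z o (t - (ja.1 + 1)) ja.2)

variable {α : Fin N → ℝ} {β μx : XIdx k → ℝ} {z e : ℤ → ZIdx k → H} {o : H}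

lemma sum_BMat_smul (f : XIdx k → H) (l : Fin N) :
    ∑ a, BMat β l a • f a = ∑ a : Fin (k l), β ⟨l, a⟩ • f ⟨l, a⟩ := by
  rw [Fintype.sum_sigma, Finset.sum_eq_single l]
  · simp [BMat]
  · intro i _ hi
    simp [BMat, hi]
  · simp

lemma sum_smul_eq_sum_regY_add_sum_regX (M : Matrix (ZIdx k) (ZIdx k) ℝ) (t : ℤ) (i : Fin N) :
    ∑ b, M (Sum.inr i) b • z t b =
      ∑ l, M.toBlocks₂₂ i l • regY α β μx z o t l +
        ∑ a, (M.toBlocks₂₁ - M.toBlocks₂₂ * BMat β) i a • regX μx z o t a -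
        (M.toBlocks₂₂.mulVec α + M.toBlocks₂₁.mulVec μx) i • o := by
  have hz_inl : ∀ a, z t (Sum.inl a) = regX μx z o t a - μx a • o := fun a =>
    (add_sub_cancel_right _ _).symm
  have hz_inr : ∀ l, z t (Sum.inr l) =
      regY α β μx z o t l - α l • o - ∑ a, BMat β l a • regX μx z o t a := fun l => by
    rw [sum_BMat_smul, regY]
    abel
  have hM₂₁ : ∀ a, M (Sum.inr i) (Sum.inl a) = M.toBlocks₂₁ i a := fun _ => rfl
  have hM₂₂ : ∀ l, M (Sum.inr i) (Sum.inr l) = M.toBlocks₂₂ i l := fun _ => rfl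
  have hB : ∑ a, (M.toBlocks₂₂ * BMat β) i a • regX μx z o t a =
      ∑ l, M.toBlocks₂₂ i l • ∑ a, BMat β l a • regX μx z o t a := by
    simp only [Matrix.mul_apply, Finset.sum_smul, Finset.smul_sum, mul_smul]
    exact Finset.sum_comm
  simp only [Fintype.sum_sum_type, hz_inl, hz_inr, Matrix.sub_apply, sub_smul,
    Finset.sum_sub_distrib, hB, Pi.add_apply, Matrix.mulVec, dotProduct, add_smul, Finset.sum_smul,
    smul_sub, mul_smul, hM₂₁, hM₂₂]
  abel

lemma map_regW {G : Type*} [AddCommGroup G] [Module ℝ G] (L : H →ₗ[ℝ] G) (i : Fin N) (t : ℤ)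
    (b : WIdx k p i) :
    L (regW α β μx z o p i t b) = regW α β μx (fun s a => L (z s a)) (L o) p i t b := by
  rcases b with _ | a | jl | ja <;> simp [regW, regY, regX]

/-- The time and the position in `z` that distinguish the nonconstant components of `w_{i,t}`. -/
def regPos (i : Fin N) (t : ℤ) :
    Fin (k i) ⊕ (Fin p × Fin N) ⊕ (Fin p × XIdx k) → ℤ × ZIdx k :=
  Sum.elim (fun a => (t, Sum.inl ⟨i, a⟩)) <|
    Sum.elim (fun jl => (t - (jl.1 + 1), Sum.inr jl.2)) fun ja => (t - (ja.1 + 1), Sum.inl ja.2)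

/-- The coefficients of the centred process in the combination `c` of the components of `w_{i,t}`,
at the positions `regPos`: a lag of `x` also occurs in the equation of the same lag of `y`. -/
def regCoeff (β : XIdx k → ℝ) {i : Fin N} (c : WIdx k p i → ℝ) :
    Fin (k i) ⊕ (Fin p × Fin N) ⊕ (Fin p × XIdx k) → ℝ :=
  Sum.elim (fun a => c (Sum.inr (Sum.inl a))) <|
    Sum.elim (fun jl => c (Sum.inr (Sum.inr (Sum.inl jl)))) fun ja =>
      c (Sum.inr (Sum.inr (Sum.inr ja))) + c (Sum.inr (Sum.inr (Sum.inl (ja.1, ja.2.1)))) * β ja.2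

lemma regPos_injective (i : Fin N) (t : ℤ) :
    Function.Injective (regPos i t : _ ⊕ (Fin p × _) ⊕ _ → ℤ × ZIdx k) := by
  rintro (a | ⟨j, l⟩ | ⟨j, a⟩) (b | ⟨j', l'⟩ | ⟨j', b⟩) h <;>
    simp only [regPos, Sum.elim_inl, Sum.elim_inr] at h <;> grind

lemma sum_smul_regW_zero (i : Fin N) (c : WIdx k p i → ℝ) (t : ℤ) :
    ∑ b, c b • regW α β μx z 0 p i t b =
      ∑ q, regCoeff β c q • z (regPos i t q).1 (regPos i t q).2 := by
  have hlag : ∀ j l, c (Sum.inr (Sum.inr (Sum.inl (j, l)))) •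
      ∑ a, β ⟨l, a⟩ • z (t - (j + 1)) (Sum.inl ⟨l, a⟩) =
        ∑ a, (c (Sum.inr (Sum.inr (Sum.inl (j, l)))) * β ⟨l, a⟩) •
          z (t - (j + 1)) (Sum.inl ⟨l, a⟩) := fun j l => by
    simp only [Finset.smul_sum, mul_smul]
  simp only [Fintype.sum_sum_type, Fintype.sum_prod_type, Fintype.sum_sigma, regW, regY, regX,
    regCoeff, regPos, Sum.elim_inl, Sum.elim_inr, smul_zero, zero_add, add_zero, smul_add, add_smul,
    Finset.sum_add_distrib, hlag, Finset.sum_const_zero]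
  abel

end Module

section InnerProductSpace

variable [NormedAddCommGroup H] [InnerProductSpace ℝ H] {α : Fin N → ℝ} {β μx : XIdx k → ℝ}
  {z e : ℤ → ZIdx k → H} {o : H}

theorem IsAutoregression.regY_eq {Ψ : Fin p → Matrix (ZIdx k) (ZIdx k) ℝ}
    (hΨ : IsAutoregression Ψ z e) (t : ℤ) (i : Fin N) :
    regY α β μx z o t i =
      ∑ b, thetaVec α β μx Ψ i b • regW α β μx z o p i t b + e t (Sum.inr i) := by
  have hγ : gammaVec α μx Ψ i =
      α i - ∑ j, ((Ψ j).toBlocks₂₂.mulVec α + (Ψ j).toBlocks₂₁.mulVec μx) i := by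
    simp only [gammaVec, Pi.sub_apply, Pi.add_apply, Matrix.sub_mulVec, Matrix.one_mulVec,
      Matrix.sum_mulVec, Finset.sum_apply, Finset.sum_add_distrib]
    ring
  rw [regY, hΨ t (Sum.inr i)]
  simp only [sum_smul_eq_sum_regY_add_sum_regX (α := α) (β := β) (μx := μx) (o := o), thetaVec,
    LambdaMat, regW, Fintype.sum_sum_type, Sum.elim_inl, Sum.elim_inr, hγ, Fintype.sum_prod_type,
    Finset.univ_unique, Finset.sum_singleton, sub_smul, Finset.sum_smul, Finset.sum_sub_distrib,
    Finset.sum_add_distrib]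
  abel

theorem linearIndependent_regW (hz : LinearIndependent ℝ fun q : ℤ × ZIdx k => z q.1 q.2)
    (ho : ∀ t a, inner ℝ (z t a) o = 0) (ho_ne : o ≠ 0) (i : Fin N) (t : ℤ) :
    LinearIndependent ℝ (regW α β μx z o p i t) := by
  rw [Fintype.linearIndependent_iff]
  intro c hc
  let P := (ℝ ∙ o)ᗮ.starProjection
  have hPo : P o = 0 :=
    Submodule.starProjection_orthogonal_apply_eq_zero (Submodule.mem_span_singleton_self o)
  have hPz : ∀ s a, P (z s a) = z s a := fun s a =>
    Submodule.starProjection_eq_self_iff.2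
      (Submodule.mem_orthogonal_singleton_iff_inner_left.2 (ho s a))
  have hcentred : ∑ b, c b • regW α β μx z 0 p i t b = 0 := by
    have hPW : ∀ b, P (regW α β μx z o p i t b) = regW α β μx z 0 p i t b := fun b => by
      simpa only [ContinuousLinearMap.coe_coe, hPz, hPo] using
        map_regW (α := α) (β := β) (μx := μx) (z := z) (o := o) P.toLinearMap i t b
    simpa only [map_sum, map_smul, hPW, map_zero] using congrArg P hc
  rw [sum_smul_regW_zero] at hcentred
  have hcoeff := Fintype.linearIndependent_iff.1 (hz.comp _ (regPos_injective i t)) _ hcentred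
  have hx : ∀ a, c (Sum.inr (Sum.inl a)) = 0 := fun a => hcoeff (Sum.inl a)
  have hy : ∀ jl, c (Sum.inr (Sum.inr (Sum.inl jl))) = 0 := fun jl => hcoeff (Sum.inr (Sum.inl jl))
  have hxlag : ∀ ja, c (Sum.inr (Sum.inr (Sum.inr ja))) = 0 := fun ja => by
    simpa [regCoeff, hy] using hcoeff (Sum.inr (Sum.inr ja))
  have hconst : c (Sum.inl ()) • o = 0 := by
    simpa [Fintype.sum_sum_type, hx, hy, hxlag, regW] using hc
  rintro (_ | a | jl | ja)
  exacts [(smul_eq_zero.1 hconst).resolve_right ho_ne, hx a, hy jl, hxlag ja]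

lemma IsInnovation.inner_regW (he : IsInnovation z e) (ho : ∀ t a, inner ℝ (z t a) o = 0)
    {t : ℤ} {i : Fin N} (hxu : ∀ a, inner ℝ (e t (Sum.inr i)) (e t (Sum.inl a)) = 0)
    (b : WIdx k p i) : inner ℝ (e t (Sum.inr i)) (regW α β μx z o p i t b) = 0 := by
  have ho' := he.inner_eq_zero_of_forall_inner_eq_zero ho t (Sum.inr i)
  have hpast : ∀ (j : Fin p) b, inner ℝ (e t (Sum.inr i)) (z (t - (j + 1)) b) = 0 := fun j b =>
    he.inner_eq_zero_of_lt (by omega) _ b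
  rcases b with _ | a | jl | ja <;>
    simp [regW, regY, regX, inner_add_right, inner_sum, real_inner_smul_right, ho', hpast, hxu,
      he.inner_eq_inner]

theorem IsAutoregression.gram_regW_mulVec_thetaVec {Ψ : Fin p → Matrix (ZIdx k) (ZIdx k) ℝ}
    (hΨ : IsAutoregression Ψ z e) (he : IsInnovation z e) (ho : ∀ t a, inner ℝ (z t a) o = 0)
    {t : ℤ} {i : Fin N} (hxu : ∀ a, inner ℝ (e t (Sum.inr i)) (e t (Sum.inl a)) = 0)
    (a : WIdx k p i) :
    (Matrix.gram ℝ (regW α β μx z o p i t)).mulVec (thetaVec α β μx Ψ i) a =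
      inner ℝ (regY α β μx z o t i) (regW α β μx z o p i t a) := by
  rw [hΨ.regY_eq, inner_add_left, he.inner_regW ho hxu, add_zero]
  simp only [Matrix.mulVec, dotProduct, Matrix.gram_apply, sum_inner, real_inner_smul_left]
  exact Finset.sum_congr rfl fun b _ => by rw [real_inner_comm, mul_comm]

variable (α β μx z o)

lemma regX_mem_affineLagSpan (j : ℕ) (a : XIdx k) :
    (fun t => regX μx z o (t - j) a) ∈ affineLagSpan z o :=
  add_mem (lagged_mem_affineLagSpan z o j (Sum.inl a))
    (Submodule.smul_mem _ (μx a) (const_mem_affineLagSpan z o))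

lemma regY_mem_affineLagSpan (j : ℕ) (l : Fin N) :
    (fun t => regY α β μx z o (t - j) l) ∈ affineLagSpan z o := by
  have hsum : ∑ a : Fin (k l), β ⟨l, a⟩ • (fun t : ℤ => regX μx z o (t - j) ⟨l, a⟩) ∈
      affineLagSpan z o :=
    sum_mem fun a _ => Submodule.smul_mem _ _ (regX_mem_affineLagSpan μx z o j ⟨l, a⟩)
  convert add_mem (add_mem (Submodule.smul_mem _ (α l) (const_mem_affineLagSpan z o)) hsum)
    (lagged_mem_affineLagSpan z o j (Sum.inr l)) using 1
  ext t
  simp [regY, lagged]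

lemma regW_mem_affineLagSpan (i : Fin N) (b : WIdx k p i) :
    (fun t => regW α β μx z o p i t b) ∈ affineLagSpan z o := by
  rcases b with _ | a | jl | ja
  · exact const_mem_affineLagSpan z o
  · simpa [regW] using regX_mem_affineLagSpan μx z o 0 ⟨i, a⟩
  · simpa [regW] using regY_mem_affineLagSpan α β μx z o (jl.1 + 1) jl.2
  · simpa [regW] using regX_mem_affineLagSpan μx z o (ja.1 + 1) ja.2

end InnerProductSpace

end AugmentedRegression

section SampleMoments

variable {Ω : Type*} {N : ℕ} {k : Fin N → ℕ} {p : ℕ}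

/-- The sample moment vector `(T - p)⁻¹ ∑_{t=p+1}^T w_{i,t} y_{i,t}` in `thetaHat`. -/
def sampleCross (p : ℕ) (y : ℤ → Ω → Fin N → ℝ) (x : ℤ → Ω → XIdx k → ℝ) (i : Fin N)
    (T : ℕ) (ω : Ω) : WIdx k p i → ℝ :=
  ((T : ℝ) - p)⁻¹ • ∑ t ∈ Finset.Icc (p + 1) T, y t ω i • wVec p y x i t ω

lemma thetaHat_eq (y : ℤ → Ω → Fin N → ℝ) (x : ℤ → Ω → XIdx k → ℝ) (i : Fin N) (T : ℕ) (ω : Ω) :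
    thetaHat p y x i T ω = (sampleGram p y x i T ω)⁻¹.mulVec (sampleCross p y x i T ω) := rfl

variable [mΩ : MeasurableSpace Ω] {μ : Measure Ω}

lemma tendstoInMeasure_inv_mul_sum_Icc {F : ℤ → Ω → ℝ} {c : ℝ}
    (hF : TendstoInMeasure μ (fun n ω => cesaroMean (fun r => F (((p + 1 : ℕ) : ℤ) + r) ω) n) atTop
      fun _ => c) :
    TendstoInMeasure μ (fun (T : ℕ) ω => ((T : ℝ) - p)⁻¹ * ∑ t ∈ Finset.Icc (p + 1) T, F t ω) atTop
      fun _ => c := by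
  have hreindex : ∀ (n : ℕ) ω, cesaroMean (fun r => F (((p + 1 : ℕ) : ℤ) + r) ω) n =
      (((n + p : ℕ) : ℝ) - p)⁻¹ * ∑ t ∈ Finset.Icc (p + 1) (n + p), F t ω := fun n ω => by
    rw [← Finset.Ico_add_one_right_eq_Icc, Finset.sum_Ico_eq_sum_range, add_assoc,
      Nat.add_sub_cancel]
    simp only [cesaroMean, smul_eq_mul, Nat.cast_add, add_sub_cancel_right]
  intro ε hε
  rw [← tendsto_add_atTop_iff_nat p]
  simpa only [hreindex] using hF ε hε

variable {α : Fin N → ℝ} {β μx : XIdx k → ℝ} {x : ℤ → Ω → XIdx k → ℝ} {u : ℤ → Ω → Fin N → ℝ}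

lemma BD.ebd {Z : ℤ → Ω → ZIdx k → ℝ} {Ψ : Fin p → Matrix (ZIdx k) (ZIdx k) ℝ} (h : BD μ Z Ψ) :
    EBD μ Z := h.2.2

lemma GEXOG.ebd {Z : ℤ → Ω → ZIdx k → ℝ} {Ψ : Fin p → Matrix (ZIdx k) (ZIdx k) ℝ}
    (h : GEXOG μ Z Ψ) : EBD μ Z := h.2

lemma EBD.inner_innovL2 {Z : ℤ → Ω → ZIdx k → ℝ} (h : EBD μ Z) (t : ℤ) (i : Fin N) (a : XIdx k) :
    inner ℝ (innovL2 μ Z t (Sum.inr i)) (innovL2 μ Z t (Sum.inl a)) = 0 := by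
  have hcov : innovCov μ Z t (Sum.inl a) (Sum.inr i) = 0 := congrFun₂ (h t) a i
  rwa [innovCov_eq_gram, Matrix.gram_apply, real_inner_comm] at hcov

variable [IsProbabilityMeasure μ]

lemma integral_zbar (hS : CovStationary μ (zbar μx x u)) (hx : ∀ t a, ∫ ω, x t ω a ∂μ = μx a)
    (hu : ∀ t i, ∫ ω, u t ω i ∂μ = 0) (t : ℤ) : ∀ a, ∫ ω, zbar μx x u t ω a ∂μ = 0
  | Sum.inr i => hu t i
  | Sum.inl a => by
    have hcentred : Integrable (fun ω => x t ω a - μx a) μ :=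
      (hS.memLp t (Sum.inl a)).integrable one_le_two
    have hxint : Integrable (fun ω => x t ω a) μ :=
      (hcentred.add (integrable_const (μx a))).congr (ae_of_all _ fun ω => sub_add_cancel _ _)
    have hsub := integral_sub hxint (integrable_const (μx a))
    rwa [hx, integral_const, probReal_univ, one_smul, sub_self] at hsub

lemma coeFn_regX (hS : CovStationary μ (zbar μx x u)) (t : ℤ) (a : XIdx k) :
    (regX μx (procL2 μ (zbar μx x u)) (Lp.const 2 μ 1) t a : Lp ℝ 2 μ) =ᵐ[μ] fun ω => x t ω a := by
  have hadd := Lp.coeFn_add (procL2 μ (zbar μx x u) t (Sum.inl a)) (μx a • Lp.const 2 μ 1)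
  filter_upwards [hadd, Lp.coeFn_smul (μx a) (Lp.const 2 μ (1 : ℝ)), Lp.coeFn_const 2 μ (1 : ℝ),
    hS.coeFn_procL2 t (Sum.inl a)] with ω hadd hsmul hone hz
  rw [regX, hadd, Pi.add_apply, hsmul, Pi.smul_apply, hone, hz]
  simp [zbar]

lemma coeFn_regY (hS : CovStationary μ (zbar μx x u)) (t : ℤ) (i : Fin N) :
    (regY α β μx (procL2 μ (zbar μx x u)) (Lp.const 2 μ 1) t i : Lp ℝ 2 μ)
      =ᵐ[μ] fun ω => yProc α β x u t ω i := by
  have hsum := coeFn_sum_smul (fun a : Fin (k i) => β ⟨i, a⟩) fun a => coeFn_regX hS t ⟨i, a⟩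
  have hconst := Lp.coeFn_smul (α i) (Lp.const 2 μ (1 : ℝ))
  filter_upwards [Lp.coeFn_add (α i • Lp.const 2 μ (1 : ℝ) + ∑ a : Fin (k i), β ⟨i, a⟩ •
      regX μx (procL2 μ (zbar μx x u)) (Lp.const 2 μ 1) t ⟨i, a⟩)
      (procL2 μ (zbar μx x u) t (Sum.inr i)),
    Lp.coeFn_add (α i • Lp.const 2 μ (1 : ℝ)) (∑ a : Fin (k i), β ⟨i, a⟩ •
      regX μx (procL2 μ (zbar μx x u)) (Lp.const 2 μ 1) t ⟨i, a⟩),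
    hconst, Lp.coeFn_const 2 μ (1 : ℝ), hsum, hS.coeFn_procL2 t (Sum.inr i)]
    with ω hadd hadd' hconst hone hsum hz
  rw [regY, hadd, Pi.add_apply, hadd', Pi.add_apply, hconst, Pi.smul_apply, hone, hsum, hz]
  simp [zbar, yProc, mul_comm]

lemma coeFn_regW (hS : CovStationary μ (zbar μx x u)) (i : Fin N) (t : ℤ) (b : WIdx k p i) :
    (regW α β μx (procL2 μ (zbar μx x u)) (Lp.const 2 μ 1) p i t b : Lp ℝ 2 μ)
      =ᵐ[μ] fun ω => wVec p (yProc α β x u) x i t ω b := by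
  rcases b with _ | a | jl | ja
  · exact Lp.coeFn_const 2 μ 1
  · exact coeFn_regX hS t ⟨i, a⟩
  · exact coeFn_regY hS _ jl.2
  · exact coeFn_regX hS _ ja.2

variable {Ψ : Fin p → Matrix (ZIdx k) (ZIdx k) ℝ}

lemma IsVAR.tendstoInMeasure_sampleGram (hΨ : IsVAR μ (zbar μx x u) p Ψ)
    (hS : CovStationary μ (zbar μx x u)) (hm : ∀ t a, ∫ ω, zbar μx x u t ω a ∂μ = 0)
    (hpnd : PurelyNondeterministic μ (zbar μx x u))
    (hα : Tendsto (alphaMix μ (innov μ (zbar μx x u))) atTop (𝓝 0))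
    (hUI : UniformIntegrable (innov μ (zbar μx x u)) 2 μ) (i : Fin N) (a b : WIdx k p i) :
    TendstoInMeasure μ (fun T ω => sampleGram p (yProc α β x u) x i T ω a b) atTop fun _ =>
      Matrix.gram ℝ (regW α β μx (procL2 μ (zbar μx x u)) (Lp.const 2 μ 1) p i 0) a b := by
  have hlim := tendstoInMeasure_inv_mul_sum_Icc
    (F := fun t ω => wVec p (yProc α β x u) x i t ω a * wVec p (yProc α β x u) x i t ω b)
    (hΨ.tendstoInMeasure_cesaroMean_mul hS hm hpnd hα hUI
      (regW_mem_affineLagSpan α β μx _ _ i a) (regW_mem_affineLagSpan α β μx _ _ i b)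
      (fun t => coeFn_regW hS i t a) (fun t => coeFn_regW hS i t b) (p + 1 : ℕ))
  simpa only [sampleGram, Matrix.smul_apply, Matrix.sum_apply, Matrix.vecMulVec_apply, smul_eq_mul,
    Matrix.gram_apply] using hlim

lemma IsVAR.tendstoInMeasure_sampleCross (hΨ : IsVAR μ (zbar μx x u) p Ψ)
    (hS : CovStationary μ (zbar μx x u)) (hm : ∀ t a, ∫ ω, zbar μx x u t ω a ∂μ = 0)
    (hpnd : PurelyNondeterministic μ (zbar μx x u))
    (hα : Tendsto (alphaMix μ (innov μ (zbar μx x u))) atTop (𝓝 0))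
    (hUI : UniformIntegrable (innov μ (zbar μx x u)) 2 μ) (i : Fin N) (a : WIdx k p i) :
    TendstoInMeasure μ (fun T ω => sampleCross p (yProc α β x u) x i T ω a) atTop fun _ =>
      inner ℝ (regY α β μx (procL2 μ (zbar μx x u)) (Lp.const 2 μ 1) 0 i)
        (regW α β μx (procL2 μ (zbar μx x u)) (Lp.const 2 μ 1) p i 0 a) := by
  have hY := regY_mem_affineLagSpan α β μx (procL2 μ (zbar μx x u)) (Lp.const 2 μ 1) 0 i
  simp only [Nat.cast_zero, sub_zero] at hY
  have hlim := tendstoInMeasure_inv_mul_sum_Icc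
    (F := fun t ω => yProc α β x u t ω i * wVec p (yProc α β x u) x i t ω a)
    (hΨ.tendstoInMeasure_cesaroMean_mul hS hm hpnd hα hUI hY
      (regW_mem_affineLagSpan α β μx _ _ i a) (fun t => coeFn_regY hS t i)
      (fun t => coeFn_regW hS i t a) (p + 1 : ℕ))
  simpa only [sampleCross, Pi.smul_apply, Finset.sum_apply, smul_eq_mul] using hlim

end SampleMoments

end Durbin

end

theorem lemma3_general {Ω : Type*} [MeasurableSpace Ω] (μ : Measure Ω) [IsProbabilityMeasure μ]
    {N : ℕ} {k : Fin N → ℕ} (p : ℕ)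
    (α : Fin N → ℝ) (β : Durbin.XIdx k → ℝ) (μx : Durbin.XIdx k → ℝ)
    (x : ℤ → Ω → Durbin.XIdx k → ℝ) (u : ℤ → Ω → Fin N → ℝ)
    (hx : ∀ t a, ∫ ω, x t ω a ∂μ = μx a) (hu : ∀ t i, ∫ ω, u t ω i ∂μ = 0)
    (hS : Durbin.CovStationary μ (Durbin.zbar μx x u))
    (hpnd : Durbin.PurelyNondeterministic μ (Durbin.zbar μx x u))
    (hF : Durbin.FinitePredictor μ (Durbin.zbar μx x u) p)
    (hα : Tendsto (Durbin.alphaMix μ (Durbin.innov μ (Durbin.zbar μx x u))) atTop (𝓝 0))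
    (hUI : UniformIntegrable (Durbin.innov μ (Durbin.zbar μx x u)) 2 μ)
    (hpd : ∀ t, (Durbin.innovCov μ (Durbin.zbar μx x u) t).PosDef) :
    (∃! Ψ : Fin p → Matrix (Durbin.ZIdx k) (Durbin.ZIdx k) ℝ,
      Durbin.IsVAR μ (Durbin.zbar μx x u) p Ψ) ∧
    ∀ Ψ : Fin p → Matrix (Durbin.ZIdx k) (Durbin.ZIdx k) ℝ,
      Durbin.IsVAR μ (Durbin.zbar μx x u) p Ψ → Durbin.EBD μ (Durbin.zbar μx x u) →
      ∀ i : Fin N,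
        Tendsto (fun T : ℕ => μ {ω | ¬ IsUnit
          (Durbin.sampleGram p (Durbin.yProc α β x u) x i T ω).det}) atTop (𝓝 0) ∧
        TendstoInMeasure μ
          (fun (T : ℕ) ω => Durbin.thetaHat p (Durbin.yProc α β x u) x i T ω) atTop
          (fun _ => Durbin.thetaVec α β μx Ψ i) := by
  have hm := Durbin.integral_zbar hS hx hu
  refine ⟨Durbin.existsUnique_isVAR hS hm hF hpd, fun Ψ hΨ hE i => ?_⟩
  have hone : Lp.const 2 μ (1 : ℝ) ≠ 0 := norm_ne_zero_iff.1 (by simp [Lp.norm_const'])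
  have hind := Durbin.linearIndependent_regW (α := α) (β := β) (μx := μx) (p := p)
    (Durbin.linearIndependent_procL2 hpd) (hS.inner_procL2_one hm) hone i 0
  have hdet := isUnit_iff_ne_zero.2 (Matrix.det_gram_ne_zero_iff_linearIndependent.2 hind)
  have hgram := hΨ.tendstoInMeasure_sampleGram (α := α) (β := β) hS hm hpnd hα hUI i
  refine ⟨Durbin.tendsto_measure_not_isUnit_det hgram hdet, ?_⟩
  simp only [Durbin.thetaHat_eq]
  refine Durbin.tendstoInMeasure_inv_mulVec hgram hdet fun a => ?_
  rw [(hS.isVAR_iff.1 hΨ).gram_regW_mulVec_thetaVec Durbin.isInnovation_innovL2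
    (hS.inner_procL2_one hm) (hE.inner_innovL2 0 i)]
  exact hΨ.tendstoInMeasure_sampleCross hS hm hpnd hα hUI i a

theorem lemma3 {Ω : Type*} [MeasurableSpace Ω] (μ : Measure Ω) [IsProbabilityMeasure μ]
    {N : ℕ} {k : Fin N → ℕ} (p₀ : ℕ)
    (α : Fin N → ℝ) (β : Durbin.XIdx k → ℝ) (μx : Durbin.XIdx k → ℝ)
    (x : ℤ → Ω → Durbin.XIdx k → ℝ) (u : ℤ → Ω → Fin N → ℝ)
    (hx : ∀ t a, ∫ ω, x t ω a ∂μ = μx a) (hu : ∀ t i, ∫ ω, u t ω i ∂μ = 0)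
    (h1 : Durbin.Assumption1 μ (Durbin.zbar μx x u) p₀)
    (h2 : Durbin.Assumption2 μ x) :
    (∃! Ψ : Fin p₀ → Matrix (Durbin.ZIdx k) (Durbin.ZIdx k) ℝ,
      Durbin.IsVAR μ (Durbin.zbar μx x u) p₀ Ψ) ∧
    ∀ Ψ : Fin p₀ → Matrix (Durbin.ZIdx k) (Durbin.ZIdx k) ℝ,
      Durbin.IsVAR μ (Durbin.zbar μx x u) p₀ Ψ →
      (Durbin.BD μ (Durbin.zbar μx x u) Ψ ∨ Durbin.GEXOG μ (Durbin.zbar μx x u) Ψ ∨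
        Durbin.EBD μ (Durbin.zbar μx x u)) →
      ∀ i : Fin N,
        Tendsto (fun T : ℕ => μ {ω | ¬ IsUnit
          (Durbin.sampleGram p₀ (Durbin.yProc α β x u) x i T ω).det}) atTop (𝓝 0) ∧
        TendstoInMeasure μ
          (fun (T : ℕ) ω => Durbin.thetaHat p₀ (Durbin.yProc α β x u) x i T ω) atTop
          (fun _ => Durbin.thetaVec α β μx Ψ i) := by
  obtain ⟨hex, hlim⟩ := lemma3_general μ p₀ α β μx x u hx hu h1.covStationary h1.purelyNondet
    h1.finitePredictor h1.tendsto_alphaMix_innov h1.uniformIntegrable_innov h1.posDef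
  exact ⟨hex, fun Ψ hΨ hcond => hlim Ψ hΨ (hcond.elim (·.ebd) (·.elim (·.ebd) id))⟩
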